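/- A $\Gamma$-twist over a locally compact Hausdorff groupoid $G$, where $\Gamma$ is a locally compact Hausdorff abelian group, is a locally compact Hausdorff groupoid $\Sigma$ with continuous groupoid homomorphisms $G^{(0)}\times\Gamma\xrightarrow{\iota}\Sigma\xrightarrow{\pi}G$ such that $\iota$ is a topological embedding, $\pi$ is a quotient map, both restrict to homeomorphisms of unit spaces (so $\Sigma^{(0)}=\iota(G^{(0)}\times\{e\})$, identified with $G^{(0)}$ via $\pi$), $\iota(G^{(0)}\times\Gamma)=\pi^{-1}(G^{(0)})$, and $\iota(r(\sigma),\alpha)\sigma=\sigma\iota(s(\sigma),\alpha)=:\alpha\cdot\sigma$ for all $\sigma\in\Sigma$, $\alpha\in\Gamma$. Let $\Gamma$ be a compact Hausdorff abelian group with normalised Haar measure, $G$ a locally compact Hausdorff groupoid with a Haar system $\{\lambda^u\}_{u\in G^{(0)}}$, $(\Sigma,\iota,\pi)$ a $\Gamma$-twist over $G$, and $\chi:\Gamma\to\mathbb T$ a continuous character. Let $\mathfrak s:G\to\Sigma$ be any section of $\pi$, let $\mu^u$ be the Radon measure on $\Sigma$ with $\int f\,d\mu^u=\int_{G}\int_\Gamma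 f(\alpha\cdot\mathfrak s(\gamma))\,d\alpha\,d\lambda^u(\gamma)$ for $f\in C_c(\Sigma)$, and let $\mu_u$ be its image under inversion. Let $C_c(\Sigma;G;\chi)$ be the $*$-algebra of all $f\in C_c(\Sigma)$ with $f(\alpha\cdot\sigma)=\chi(\alpha)f(\sigma)$, with product $(f*g)(\sigma)=\int f(\tau)g(\tau^{-1}\sigma)\,d\mu^{r(\sigma)}(\tau)$ and involution $f^*(\sigma)=\overline{f(\sigma^{-1})}$. The full $\Gamma$-twisted groupoid $C^*$-algebra $C^*(\Sigma;G;\chi)$ is its completion in the norm $\sup_L\|L(f)\|$, over all $*$-representations $L$ on Hilbert spaces with $\|L(f)\|\le\|f\|_I:=\max\{\sup_u\int|f|\,d\mu_u,\ \sup_u\int|f|\,d\mu^u\}$; the reduced one $C^*_r(\Sigma;G;\chi)$ is its completion in the norm $\sup_u\|\mathrm{Ind}\,\delta_u(f)\|$, where $\mathrm{Ind}\,\delta_u(f)$ is the bounded operator on $L^2(\Sigma_u,\mu_u)$ extending $g\mapsto f*g$, $g\in C_c(\Sigma)$. Then there are a twist over $G$, i.e. a $\mathbb T$-twist $(\Sigma',\iota',\pi')$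 over $G$, and a continuous groupoid homomorphism $\theta:\Sigma\to\Sigma'$ with $\theta(\iota(u,\alpha))=\iota'(u,\chi(\alpha))$ and $\pi'\circ\theta=\pi$, such that, with the same Haar system on $G$, there is a $*$-isomorphism $\Upsilon:C_c(\Sigma;G;\chi)\to C_c(\Sigma';G;\mathrm{id}_{\mathbb T})$ with $\Upsilon(f)\circ\theta=f$ for all $f$, and $\Upsilon$ extends to $*$-isomorphisms $$C^*(\Sigma;G;\chi)\cong C^*(\Sigma';G;\mathrm{id}_{\mathbb T}),\qquad C^*_r(\Sigma;G;\chi)\cong C^*_r(\Sigma';G;\mathrm{id}_{\mathbb T})$$ of the full and reduced $\Gamma$-twisted groupoid $C^*$-algebras of $(\Sigma,\iota,\pi)$ and $\chi$ onto the full and reduced twisted groupoid $C^*$-algebras of $(\Sigma',\iota',\pi')$. -/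

import Mathlib

open MeasureTheory Topology
open scoped ENNReal CompactlySupported

universe u v w

namespace GammaTwist

/-! ## Topological groupoids -/

/-- A topological groupoid, given by its space `G` of arrows.  The product `mul x y` is meaningful
only if `s x = r y`; for other pairs its value is irrelevant.  Units are identified with the
arrows `x` such that `r x = x`. -/
class TopologicalGroupoid (G : Type*) [TopologicalSpace G] where
  r : G → G
  s : G → G
  mul : G → G → G
  inv : G → G
  r_mul : ∀ x y, s x = r y → r (mul x y) = r x
  s_mul : ∀ x y, s x = r y → s (mul x y) = s y
  assoc : ∀ x y z, s x = r y → s y = r z → mul (mul x y) z = mul x (mul y z)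
  r_inv : ∀ x, r (inv x) = s x
  s_inv : ∀ x, s (inv x) = r x
  mul_inv_self : ∀ x, mul x (inv x) = r x
  inv_mul_self : ∀ x, mul (inv x) x = s x
  r_mul_self : ∀ x, mul (r x) x = x
  mul_s_self : ∀ x, mul x (s x) = x
  continuousOn_mul : ContinuousOn (fun p : G × G => mul p.1 p.2) {p | s p.1 = r p.2}
  continuous_inv : Continuous inv

open TopologicalGroupoid

section Groupoid

variable {G H : Type*} [TopologicalSpace G] [TopologicalSpace H] [TopologicalGroupoid G]
  [TopologicalGroupoid H]

theorem r_r (x : G) : r (r x) = r x := by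
  rw [← mul_inv_self x, r_mul _ _ (r_inv x).symm, mul_inv_self]

theorem s_r (x : G) : s (r x) = r x := by
  rw [← mul_inv_self x, s_mul _ _ (r_inv x).symm, s_inv, mul_inv_self]

theorem r_s (x : G) : r (s x) = s x := by
  rw [← r_inv x, r_r]

theorem eq_r_of_mul_self {x : G} (h : s x = r x) (hx : mul x x = x) : x = r x := by
  have h1 : mul (mul x x) (inv x) = mul x (mul x (inv x)) :=
    assoc x x (inv x) h (r_inv x).symm
  rw [hx, mul_inv_self, ← h, mul_s_self] at h1
  rw [← h, h1]

variable (G) in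
/-- The unit space `G⁽⁰⁾`. -/
def units : Set G := {x | r x = x}

/-- The range map, with values in the unit space. -/
def rng (x : G) : units G := ⟨r x, r_r x⟩

/-- The source map, with values in the unit space. -/
def src (x : G) : units G := ⟨s x, r_s x⟩

/-- Homomorphisms of groupoids: composable pairs are sent to composable pairs, and products to
products. -/
def IsGroupoidHom (φ : G → H) : Prop :=
  ∀ x y, s x = r y → s (φ x) = r (φ y) ∧ φ (mul x y) = mul (φ x) (φ y)

theorem IsGroupoidHom.mapsTo {φ : G → H} (hφ : IsGroupoidHom φ) :
    Set.MapsTo φ (units G) (units H) := by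
  intro x hx
  have hx' : r x = x := hx
  have hs : s x = r x := by rw [← hx', s_r, r_r]
  have hm : mul x x = x := by
    have := r_mul_self x
    rwa [hx'] at this
  obtain ⟨h1, h2⟩ := hφ x x hs
  rw [hm] at h2
  exact (eq_r_of_mul_self h1 h2.symm).symm

/-- The trivial group bundle `G⁽⁰⁾ × Γ`, a group bundle over `G⁽⁰⁾` with all fibres equal to `Γ`. -/
instance trivialBundle (Γ : Type*) [CommGroup Γ] [TopologicalSpace Γ] [IsTopologicalGroup Γ] :
    TopologicalGroupoid (units G × Γ) where
  r p := (p.1, 1)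
  s p := (p.1, 1)
  mul p q := (p.1, p.2 * q.2)
  inv p := (p.1, p.2⁻¹)
  r_mul _ _ _ := rfl
  s_mul p q h := by simpa using h
  assoc p q t _ _ := by simp [mul_assoc]
  r_inv _ := rfl
  s_inv _ := rfl
  mul_inv_self p := by simp
  inv_mul_self p := by simp
  r_mul_self p := by simp
  mul_s_self p := by simp
  continuousOn_mul := by fun_prop
  continuous_inv := by fun_prop

/-- A Haar system on `G`: a family of Radon measures `λ^u`, `u ∈ G⁽⁰⁾`, with `supp λ^u = G^u`,
continuous in `u` against functions in `C_c(G)`, and left invariant. -/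
structure HaarSystem (G : Type*) [TopologicalSpace G] [TopologicalGroupoid G] where
  meas : units G → @Measure G (borel G)
  regular : ∀ u, @Measure.Regular G (borel G) _ (meas u)
  support_eq : ∀ u : units G, @Measure.support G _ (borel G) (meas u) = {x : G | r x = (u : G)}
  continuous_integral : ∀ f : C_c(G, ℂ), Continuous fun u => ∫ x, f x ∂(meas u)
  left_invariant : ∀ (x : G) (f : C_c(G, ℂ)),
    ∫ y, f (mul x y) ∂(meas (src x)) = ∫ y, f y ∂(meas (rng x))

end Groupoid

/-- The normalised Haar measure on a compact group. -/
noncomputable def normHaar (Γ : Type*) [CommGroup Γ] [TopologicalSpace Γ] [IsTopologicalGroup Γ]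
    [CompactSpace Γ] : @Measure Γ (borel Γ) :=
  letI : MeasurableSpace Γ := borel Γ
  haveI : BorelSpace Γ := ⟨rfl⟩
  Measure.haarMeasure (⊤ : TopologicalSpace.PositiveCompacts Γ)

/-- The C⋆-algebra of norm-bounded families `(x_i)` of bounded operators `x_i` on the Hilbert
spaces `E i`, with pointwise operations and the norm `sup_i ‖x_i‖`. -/
abbrev BoundedFamily {I : Type*} (E : I → Type*) [∀ i, NormedAddCommGroup (E i)]
    [∀ i, InnerProductSpace ℂ (E i)] [∀ i, CompleteSpace (E i)] : Type _ :=
  lp (fun i => E i →L[ℂ] E i) ∞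

noncomputable instance {I : Type*} (E : I → Type*) [∀ i, NormedAddCommGroup (E i)]
    [∀ i, InnerProductSpace ℂ (E i)] [∀ i, CompleteSpace (E i)] :
    NonUnitalCStarAlgebra (BoundedFamily E) :=
  inferInstance

theorem BoundedFamily.enorm_eq {I : Type*} {E : I → Type*} [∀ i, NormedAddCommGroup (E i)]
    [∀ i, InnerProductSpace ℂ (E i)] [∀ i, CompleteSpace (E i)] (x : BoundedFamily E) :
    ‖x‖ₑ = ⨆ i, ‖x i‖ₑ := by
  apply le_antisymm
  · by_cases h : (⨆ i, ‖x i‖ₑ) = ∞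
    · simp [h]
    · rw [← ENNReal.coe_toNNReal h, enorm_le_coe, ← NNReal.coe_le_coe, coe_nnnorm]
      refine lp.norm_le_of_forall_le (NNReal.coe_nonneg _) fun i => ?_
      rw [← coe_nnnorm, NNReal.coe_le_coe, ← enorm_le_coe, ENNReal.coe_toNNReal h]
      exact le_iSup (fun i => ‖x i‖ₑ) i
  · refine iSup_le fun i => ?_
    rw [enorm_le_iff_norm_le]
    exact lp.norm_apply_le_norm ENNReal.top_ne_zero x i

/-- The closure of a set `s` that is a `*`-subalgebra; in general, the C⋆-subalgebra generated
by `s`. -/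
noncomputable def cstarClosure {A : Type*} [NonUnitalCStarAlgebra A] (s : Set A) :
    NonUnitalStarSubalgebra ℂ A :=
  (NonUnitalStarAlgebra.adjoin ℂ s).topologicalClosure

noncomputable instance {A : Type*} [NonUnitalCStarAlgebra A] (s : Set A) :
    NonUnitalCStarAlgebra (cstarClosure s) :=
  haveI : IsClosed (cstarClosure s : Set A) :=
    NonUnitalStarSubalgebra.isClosed_topologicalClosure _
  inferInstance

/-! ## Twists -/

/-- A `Γ`-twist `G⁽⁰⁾ × Γ —ι→ S —π→ G` over `G`. -/
structure Twist (Γ : Type*) (G : Type*) (S : Type*) [CommGroup Γ] [TopologicalSpace Γ]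
    [IsTopologicalGroup Γ] [TopologicalSpace G] [TopologicalGroupoid G]
    [TopologicalSpace S] [TopologicalGroupoid S] where
  ι : units G × Γ → S
  π : S → G
  units_eq : units S = ι '' {p | p.2 = 1}
  hom_ι : IsGroupoidHom ι
  hom_π : IsGroupoidHom π
  isEmbedding_ι : IsEmbedding ι
  isQuotientMap_π : IsQuotientMap π
  isHomeomorph_ι : IsHomeomorph (hom_ι.mapsTo.restrict ι (units (units G × Γ)) (units S))
  isHomeomorph_π : IsHomeomorph (hom_π.mapsTo.restrict π (units S) (units G))
  exact : Set.range ι = π ⁻¹' units G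
  /-- The image of `ι` is central.  The unit spaces are identified through `π`, so `r(σ)` as a
  point of `G⁽⁰⁾` is `π (r σ)`; both products are required to be defined. -/
  central : ∀ (σ : S) (α : Γ),
    s (ι (⟨π (r σ), hom_π.mapsTo (r_r σ)⟩, α)) = r σ ∧
    r (ι (⟨π (s σ), hom_π.mapsTo (r_s σ)⟩, α)) = s σ ∧
    mul (ι (⟨π (r σ), hom_π.mapsTo (r_r σ)⟩, α)) σ =
      mul σ (ι (⟨π (s σ), hom_π.mapsTo (r_s σ)⟩, α))

namespace Twist

section Basic

variable {Γ : Type w} {G : Type u} {S : Type v} [CommGroup Γ] [TopologicalSpace Γ]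
  [IsTopologicalGroup Γ] [TopologicalSpace G] [TopologicalGroupoid G]
  [TopologicalSpace S] [TopologicalGroupoid S] (T : Twist Γ G S)

/-- The range of `σ ∈ S`, as a point of `G⁽⁰⁾`, under the identification of `S⁽⁰⁾` with `G⁽⁰⁾`
through `π`. -/
def base (σ : S) : units G := ⟨T.π (r σ), T.hom_π.mapsTo (r_r σ)⟩

/-- The action `α · σ = ι(r(σ), α) σ` of `Γ` on `S`. -/
def act (α : Γ) (σ : S) : S := mul (T.ι (T.base σ, α)) σ

/-- A (not necessarily continuous) section of `π`. -/
noncomputable def sec : G → S := Function.surjInv T.isQuotientMap_π.surjective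

/-- The space `C_c(Σ; G; χ)` of functions `f ∈ C_c(Σ)` such that `f(α · σ) = χ(α) f(σ)`. -/
def equivariantCc (χ : Γ →ₜ* Circle) : Submodule ℂ C_c(S, ℂ) where
  carrier := {f | ∀ α σ, f (T.act α σ) = (χ α : ℂ) * f σ}
  zero_mem' := by simp
  add_mem' := by
    intro f g hf hg α σ
    simp [hf α σ, hg α σ, mul_add]
  smul_mem' := by
    intro c f hf α σ
    simp [hf α σ, mul_left_comm]

end Basic

section Algebra

variable {Γ : Type w} {G : Type u} {S : Type v} [CommGroup Γ] [TopologicalSpace Γ]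
  [IsTopologicalGroup Γ] [CompactSpace Γ] [TopologicalSpace G] [TopologicalGroupoid G]
  [TopologicalSpace S] [TopologicalGroupoid S] (T : Twist Γ G S) (χ : Γ →ₜ* Circle)
  (lam : HaarSystem G)

/-- `μ` is the Radon measure on `S` that represents the functional
`f ↦ ∫_{G^u} ∫_Γ f(α · 𝔰(γ)) dα dλ^u(γ)` on `C_c(S)`, where `𝔰` is a section of `π`. -/
def IsInducedMeasure (u : units G) (μ : @Measure S (borel S)) : Prop :=
  @Measure.Regular S (borel S) _ μ ∧
    ∀ f : C_c(S, ℂ), ∫ σ, f σ ∂μ = ∫ γ, (∫ α, f (T.act α (T.sec γ)) ∂(normHaar Γ)) ∂(lam.meas u)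

/-- The Haar system `μ^u`, `u ∈ S⁽⁰⁾ = G⁽⁰⁾`, on `S` induced by the Haar system of `G`: `μ^u` is
the unique Radon measure as above given by the Riesz representation theorem. -/
noncomputable def haar (u : units G) : @Measure S (borel S) :=
  Classical.epsilon (T.IsInducedMeasure lam u)

/-- The measure `μ_u`, the image of `μ^u` under inversion. -/
noncomputable def haarInv (u : units G) : @Measure S (borel S) :=
  @Measure.map S S (borel S) (borel S) inv (T.haar lam u)

/-- Convolution `(f * g)(σ) = ∫ f(τ) g(τ⁻¹σ) dμ^{r(σ)}(τ)`. -/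
noncomputable def conv (f g : S → ℂ) (σ : S) : ℂ :=
  ∫ τ, f τ * g (mul (inv τ) σ) ∂(T.haar lam (T.base σ))

/-- The `I`-norm. -/
noncomputable def normI (f : S → ℂ) : ℝ≥0∞ :=
  max (⨆ u : units G, ∫⁻ σ, ‖f σ‖ₑ ∂(T.haarInv lam u)) (⨆ u : units G, ∫⁻ σ, ‖f σ‖ₑ ∂(T.haar lam u))

/-- A `*`-representation of the `*`-algebra `C_c(Σ; G; χ)` (convolution product and involution
`f^*(σ) = conj (f(σ⁻¹))`) on a Hilbert space that is bounded by the `I`-norm.  Cyclic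
representations have spaces no larger than `C_c(Σ; G; χ)`, so that Hilbert spaces in the universe
of `S` suffice to compute the supremum of `‖L(f)‖` over all representations. -/
structure Rep where
  H : Type v
  [normed : NormedAddCommGroup H]
  [inner : InnerProductSpace ℂ H]
  [complete : CompleteSpace H]
  L : T.equivariantCc χ →ₗ[ℂ] (H →L[ℂ] H)
  map_conv : ∀ f g h : T.equivariantCc χ,
    (∀ σ, h.1 σ = T.conv lam f.1 g.1 σ) → L h = L f * L g
  map_star : ∀ f h : T.equivariantCc χ,
    (∀ σ, h.1 σ = starRingEnd ℂ (f.1 (inv σ))) → L h = star (L f)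
  norm_le : ∀ f : T.equivariantCc χ, ‖L f‖ₑ ≤ T.normI lam f.1

attribute [instance] Rep.normed Rep.inner Rep.complete

/-- Bounded families of operators on the spaces of the representations. -/
abbrev FullAmbient : Type _ := BoundedFamily fun L : T.Rep χ lam => L.H

/-- `x` is the family `(L(f))_L`. -/
def IsFullImage (f : T.equivariantCc χ) (x : T.FullAmbient χ lam) : Prop :=
  ∀ L, x L = L.L f

/-- The full `Γ`-twisted groupoid C⋆-algebra `C^*(Σ; G; χ)`: the completion of `C_c(Σ; G; χ)` in
the full norm `‖f‖ = sup_L ‖L(f)‖`, realised as the closure of the image of `C_c(Σ; G; χ)`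
under the map `f ↦ (L(f))_L`, a `*`-homomorphism that is isometric for the full norm. -/
def FullCStar : Type _ := cstarClosure {x | ∃ f, T.IsFullImage χ lam f x}

noncomputable instance : NonUnitalCStarAlgebra (T.FullCStar χ lam) :=
  inferInstanceAs (NonUnitalCStarAlgebra (cstarClosure {x | ∃ f, T.IsFullImage χ lam f x}))

variable {T χ lam} in
/-- The underlying family of operators of an element of the full C⋆-algebra. -/
def FullCStar.val (x : T.FullCStar χ lam) : T.FullAmbient χ lam := Subtype.val x

/-- The Hilbert space `L²(Σ_u, μ_u)`. -/
abbrev L2 (u : units G) : Type _ := @Lp S ℂ (borel S) _ 2 (T.haarInv lam u)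

/-- `A` is the operator `Ind δ_u (f)` on `L²(Σ_u, μ_u)`: the bounded extension of `g ↦ f * g`,
`g ∈ C_c(Σ)`. -/
def IsInd (u : units G) (f : T.equivariantCc χ) (A : T.L2 lam u →L[ℂ] T.L2 lam u) : Prop :=
  ∀ (g : C_c(S, ℂ)) (ξ : T.L2 lam u),
    ξ =ᵐ[T.haarInv lam u] g → A ξ =ᵐ[T.haarInv lam u] T.conv lam f.1 g

/-- Bounded families of operators on the spaces `L²(Σ_u, μ_u)`. -/
abbrev ReducedAmbient : Type _ := BoundedFamily fun u : units G => T.L2 lam u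

/-- `x` is the family `(Ind δ_u (f))_u`. -/
def IsReducedImage (f : T.equivariantCc χ) (x : T.ReducedAmbient lam) : Prop :=
  ∀ u, T.IsInd χ lam u f (x u)

/-- The reduced `Γ`-twisted groupoid C⋆-algebra `C_r^*(Σ; G; χ)`: the completion of
`C_c(Σ; G; χ)` in the reduced norm `‖f‖_r = sup_u ‖Ind δ_u (f)‖`, realised as the closure of the
image of `C_c(Σ; G; χ)` under the map `f ↦ (Ind δ_u (f))_u`, a `*`-homomorphism that is isometric for
that norm. -/
def ReducedCStar : Type _ := cstarClosure {x | ∃ f, T.IsReducedImage χ lam f x}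

noncomputable instance : NonUnitalCStarAlgebra (T.ReducedCStar χ lam) :=
  inferInstanceAs (NonUnitalCStarAlgebra (cstarClosure {x | ∃ f, T.IsReducedImage χ lam f x}))

variable {T χ lam} in
/-- The underlying family of operators of an element of the reduced C⋆-algebra. -/
def ReducedCStar.val (x : T.ReducedCStar χ lam) : T.ReducedAmbient lam := Subtype.val x

end Algebra

end Twist

end GammaTwist

/-!
The twist `Σ'` is the push-out `(𝕋 × Σ) / Γ` of `Σ` along `χ`, where `α ∈ Γ` acts by `α · (z, σ) =
(z χ(α)⁻¹, α · σ)`, and `θ σ = [1, σ]`. Compactness of `Γ` makes the quotient map proper, hence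
`Σ'` is locally compact and Hausdorff and `(u, z) ↦ [z, ι(u, 1)]` is a closed embedding
(`Twist.Push.twist`). A function on `Σ'` that is equivariant for `𝕋` is determined by its values
at the points `[1, σ]`, and these form a `χ`-equivariant function on `Σ`; conversely `f` extends
by `[z, σ] ↦ z f(σ)` (`Twist.Push.equivariantEquiv`).

The induced measures are compared through averages over `Γ`-orbits: `∫ φ dμ^u` is the integral
against `λ^u` of the average of `φ`, a function on `G`. For the integrands of a convolution of
equivariant functions, of the `I`-norm, and of the inner product of `L²(Σ_u, μ_u)`, the function
is constant on orbits and has the same average on `Σ` and on `Σ'`. So the isomorphism respects all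
of these (`Twist.Push.isCompatible_equivariantEquiv`), and what remains holds for every such
isomorphism `e` (`Twist.IsCompatible`).

* Full algebras: representations bounded by the `I`-norm correspond to each other under `e`
  (`Twist.IsCompatible.pull`), so that re-indexing families of operators carries one algebra onto
  the other (`Twist.IsCompatible.exists_fullCStar_equiv`).
* Reduced algebras: `Ind δ_u (f)` acts on all of `L²(Σ_u, μ_u)`, but it vanishes on the orthogonal
  complement of the closure of the equivariant functions and maps into this closure
  (`Twist.IsInd.apply_toL2`, by means of the projection `Twist.proj` onto the isotypic part). On
  these closures `e` is isometric, and so defines a partial isometry `V`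
  (`Twist.IsCompatible.transfer`). The map `x ↦ V x V^*` is in general not multiplicative on all
  bounded operators, but it is so at the operators `Ind δ_u (f)`, and this is enough for it to
  restrict to an isomorphism of the generated C⋆-algebras (`exists_cstarClosure_equiv`,
  `Twist.IsCompatible.exists_reducedCStar_equiv`).

The C⋆-algebras are generated by operator families whose existence has to be shown as well: the
measures `μ^u` exist by the Riesz representation theorem (`Twist.exists_inducedMeasure`),
convolution preserves `C_c(Σ)` by continuity of integrals along fibres
(`continuous_integral_fiber`, by Tietze's theorem), and convolution by `f` is bounded on `L²(Σ_u,
μ_u)` uniformly in `u` by Schur's test (`schur_test`, `Twist.exists_reducedImage`).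
-/

namespace GammaTwist

/-! ### Integration on locally compact Hausdorff spaces -/

section Analysis

/-- The Cauchy–Schwarz inequality with weight `‖a‖`. -/
theorem norm_integral_mul_sq_le {Ω : Type*} [MeasurableSpace Ω] {μ : Measure Ω} {a b : Ω → ℂ}
    (ha : Integrable a μ) (hab : Integrable (fun x => a x * b x) μ)
    (hab2 : Integrable (fun x => ‖a x‖ * ‖b x‖ ^ 2) μ)
    {C : ℝ} (hC : ∫ x, ‖a x‖ ∂μ ≤ C) :
    ‖∫ x, a x * b x ∂μ‖ ^ 2 ≤ C * ∫ x, ‖a x‖ * ‖b x‖ ^ 2 ∂μ := by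
  set m : ℝ := ∫ x, ‖a x‖ * ‖b x‖ ∂μ with hm
  set I : ℝ := ∫ x, ‖a x‖ * ‖b x‖ ^ 2 ∂μ with hI
  set A : ℝ := ∫ x, ‖a x‖ ∂μ with hA
  have hA0 : 0 ≤ A := integral_nonneg fun x => norm_nonneg _
  have hm0 : 0 ≤ m := integral_nonneg fun x => by positivity
  have hI0 : 0 ≤ I := integral_nonneg fun x => by positivity
  have hab' : Integrable (fun x => ‖a x‖ * ‖b x‖) μ := by
    refine hab.norm.congr (Filter.Eventually.of_forall fun x => by simp)
  have h1 : ‖∫ x, a x * b x ∂μ‖ ≤ m :=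
    (norm_integral_le_integral_norm _).trans (by simp [hm])
  -- The quadratic polynomial `∫ ‖a‖ (‖b‖ - t)²` in `t` is nonnegative.
  have h2 : ∀ t : ℝ, 0 ≤ I - 2 * t * m + t ^ 2 * A := by
    intro t
    have : ∫ x, ‖a x‖ * (‖b x‖ - t) ^ 2 ∂μ = I - 2 * t * m + t ^ 2 * A := by
      rw [hI, hm, hA, ← integral_const_mul, ← integral_const_mul, ← integral_sub hab2
        (hab'.const_mul _)]
      refine Eq.trans ?_ (integral_add (hab2.sub (hab'.const_mul (2 * t)))
        (ha.norm.const_mul (t ^ 2)))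
      congr 1 with x
      ring
    rw [← this]
    exact integral_nonneg fun x => by positivity
  rcases hA0.eq_or_lt with hA0 | hA0
  · have hm' : m = 0 := by
      have := h2 (I / m + 1)
      rw [← hA0] at this
      by_contra hne
      have hmp : 0 < m := lt_of_le_of_ne hm0 (Ne.symm hne)
      have : I / m * m = I := div_mul_cancel₀ _ hne
      nlinarith
    have : ‖∫ x, a x * b x ∂μ‖ = 0 := le_antisymm (hm' ▸ h1) (norm_nonneg _)
    rw [this]
    have : 0 ≤ C * I := mul_nonneg (hA0.le.trans hC) hI0
    simpa using this
  · have h3 := h2 (m / A)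
    have h4 : m ^ 2 ≤ A * I := by
      have : I - 2 * (m / A) * m + (m / A) ^ 2 * A = (A * I - m ^ 2) / A := by field_simp; ring
      rw [this] at h3
      have := (div_nonneg_iff.1 h3).resolve_right fun h => by linarith
      linarith [this.1]
    calc ‖∫ x, a x * b x ∂μ‖ ^ 2 ≤ m ^ 2 := by gcongr
      _ ≤ A * I := h4
      _ ≤ C * I := by gcongr

variable {X : Type u} [TopologicalSpace X] [T2Space X] [LocallyCompactSpace X]

theorem exists_cutoff {K : Set X} (hK : IsCompact K) :
    ∃ ψ : C_c(X, ℝ), (∀ x ∈ K, ψ x = 1) ∧ ∀ x, 0 ≤ ψ x := by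
  obtain ⟨f, h1, -, hc, h2⟩ := exists_continuous_one_zero_of_isCompact hK isClosed_empty
    (Set.disjoint_empty K)
  exact ⟨⟨f, hc⟩, fun x hx => h1 hx, fun x => (h2 x).1⟩

/-- The Tietze extension theorem for compactly supported functions on a closed subset of a locally
compact Hausdorff space. -/
theorem exists_cc_extension {E : Type*} [NormedAddCommGroup E] [NormedSpace ℝ E]
    [TietzeExtension.{u} E] {Z : Set X} (hZ : IsClosed Z) {φ : X → E} (hφ : ContinuousOn φ Z)
    {K : Set X} (hK : IsCompact K) (h0 : ∀ x ∈ Z, x ∉ K → φ x = 0) :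
    ∃ Φ : C_c(X, E), ∀ x ∈ Z, Φ x = φ x := by
  obtain ⟨L, hL, hKL⟩ := exists_compact_superset hK
  obtain ⟨ψ, h1, h2, hc, -⟩ := exists_continuous_one_zero_of_isCompact hK
    (isOpen_interior (s := L)).isClosed_compl
    (Set.disjoint_left.2 fun x hx hx' => hx' (hKL hx))
  have hC : IsCompact (L ∩ Z) := hL.inter_right hZ
  have : CompactSpace (L ∩ Z : Set X) := isCompact_iff_compactSpace.1 hC
  -- `X` need not be normal, but its one-point compactification is.
  let e : (L ∩ Z : Set X) → OnePoint X := fun x => (x : X)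
  have he : IsClosedEmbedding e :=
    (OnePoint.continuous_coe.comp continuous_subtype_val).isClosedEmbedding
      (OnePoint.coe_injective.comp Subtype.val_injective)
  obtain ⟨g, hg⟩ := ContinuousMap.exists_extension' (Y := E) he
    ⟨fun x => φ x, (hφ.mono Set.inter_subset_right).domRestrict⟩
  refine ⟨⟨⟨fun x => ψ x • g x, by
    exact ψ.continuous.smul (g.continuous.comp OnePoint.continuous_coe)⟩, ?_⟩, ?_⟩
  · exact hc.smul_right
  · intro x hx
    change ψ x • g x = φ x
    by_cases hxL : x ∈ L
    · have : g x = φ x := congr_fun hg ⟨x, hxL, hx⟩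
      rw [this]
      by_cases hxK : x ∈ K
      · rw [h1 hxK]; simp
      · rw [h0 x hx hxK, smul_zero]
    · rw [h0 x hx fun h => hxL (interior_subset (hKL h)),
        h2 (fun h => hxL (interior_subset h))]
      simp

variable [MeasurableSpace X] [BorelSpace X]

/-- Only the restriction of `φ` to a closed set that carries `μ` matters for integrability. -/
theorem integrable_of_continuousOn_fiber {E : Type*} [NormedAddCommGroup E] [NormedSpace ℝ E]
    [TietzeExtension.{u} E] {μ : Measure X} [IsFiniteMeasureOnCompacts μ]
    {Z : Set X} (hZ : IsClosed Z) (hμ : μ Zᶜ = 0) {φ : X → E} (hφ : ContinuousOn φ Z)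
    {K : Set X} (hK : IsCompact K) (h0 : ∀ x ∈ Z, x ∉ K → φ x = 0) : Integrable φ μ := by
  obtain ⟨Φ, hΦ⟩ := exists_cc_extension hZ hφ hK h0
  refine Φ.integrable.congr ?_
  filter_upwards [compl_mem_ae_iff.2 hμ] with x hx
  exact hΦ x (not_not.1 hx)

/-- A Radon measure for which the functions in `C_c(X)` that vanish on `Z` have integral zero is
concentrated on `Z`. -/
theorem measure_compl_eq_zero_of_integral {μ : Measure X} [μ.Regular] {Z : Set X}
    (hZ : IsClosed Z) (h : ∀ φ : C_c(X, ℂ), (∀ x ∈ Z, φ x = 0) → ∫ x, φ x ∂μ = 0) :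
    μ Zᶜ = 0 := by
  rw [hZ.isOpen_compl.measure_eq_iSup_isCompact]
  simp only [ENNReal.iSup_eq_zero]
  intro K hKZ hK
  obtain ⟨ψ, h1, h2, hc, h3⟩ := exists_continuous_one_zero_of_isCompact hK hZ
    (Set.disjoint_left.2 fun x hx hx' => hKZ hx hx')
  have hψ : ∫ x, ψ x ∂μ = 0 := by
    have := h ⟨⟨fun x => (ψ x : ℂ), by fun_prop⟩, hc.comp_left (g := fun t : ℝ => (t : ℂ))
      Complex.ofReal_zero⟩ (fun x hx => by
        change ((ψ x : ℝ) : ℂ) = 0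
        rw [h2 hx]; simp)
    change ∫ x, ((ψ x : ℝ) : ℂ) ∂μ = 0 at this
    rw [integral_complex_ofReal] at this
    exact_mod_cast this
  have h4 : ψ =ᵐ[μ] 0 := (integral_eq_zero_iff_of_nonneg (fun x => (h3 x).1)
    (ψ.continuous.integrable_of_hasCompactSupport hc)).1 hψ
  refine measure_mono_null (fun x hx => ?_) h4
  change ψ x ≠ 0
  rw [h1 hx]
  simp

/-- Integration of a continuous family of compactly supported functions along the fibres of `p`,
against a continuous family of measures on these fibres, gives a continuous function. -/
theorem continuous_integral_fiber {Y B : Type*} [TopologicalSpace Y] [TopologicalSpace B]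
    [T2Space B] {ν : B → Measure X} [∀ b, IsFiniteMeasureOnCompacts (ν b)] {p : X → B} {q : Y → B}
    (hp : Continuous p) (hq : Continuous q) (hν0 : ∀ b, ν b {x | p x = b}ᶜ = 0)
    (hν : ∀ f : C_c(X, ℂ), Continuous fun b => ∫ x, f x ∂(ν b)) {F : X → Y → ℂ}
    (hF : ContinuousOn (Function.uncurry F) {z | p z.1 = q z.2}) {K : Set X} (hK : IsCompact K)
    (h0 : ∀ x y, p x = q y → x ∉ K → F x y = 0) :
    Continuous fun y => ∫ x, F x y ∂(ν (q y)) := by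
  have hZ : ∀ b, IsClosed {x | p x = b} := fun b => isClosed_eq hp continuous_const
  have hFy : ∀ y, ContinuousOn (fun x => F x y) {x | p x = q y} := fun y =>
    hF.comp (f := fun x => (x, y)) (by fun_prop) fun x hx => hx
  rw [continuous_iff_continuousAt]
  intro y₀
  obtain ⟨Φ, hΦ⟩ := exists_cc_extension (hZ (q y₀)) (hFy y₀) hK fun x hx => h0 x y₀ hx
  have hL : IsCompact (K ∪ tsupport Φ) := hK.union Φ.hasCompactSupport
  obtain ⟨ψ, h1, h2⟩ := exists_cutoff hL
  have hψc : Continuous fun b => ∫ x, ψ x ∂(ν b) := by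
    have := hν ⟨⟨fun x => (ψ x : ℂ), Complex.continuous_ofReal.comp ψ.continuous⟩,
      ψ.hasCompactSupport.comp_left (g := fun t : ℝ => (t : ℂ)) Complex.ofReal_zero⟩
    change Continuous fun b => ∫ x, (ψ x : ℂ) ∂(ν b) at this
    simp_rw [integral_complex_ofReal] at this
    exact Complex.continuous_re.comp this
  set M : ℝ := ∫ x, ψ x ∂(ν (q y₀)) + 1 with hM
  have hM0 : 0 < M := by
    have : 0 ≤ ∫ x, ψ x ∂(ν (q y₀)) := integral_nonneg h2
    linarith
  have hMev : ∀ᶠ y in 𝓝 y₀, ∫ x, ψ x ∂(ν (q y)) < M :=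
    (hψc.comp hq).continuousAt.eventually_lt continuousAt_const (by simp [hM])
  rw [ContinuousAt, Metric.tendsto_nhds]
  intro ε hε
  have hlim : ∀ᶠ y in 𝓝 y₀, dist (∫ x, Φ x ∂(ν (q y))) (∫ x, Φ x ∂(ν (q y₀))) < ε / 2 :=
    Metric.tendsto_nhds.1 ((hν Φ).comp hq).continuousAt (ε / 2) (half_pos hε)
  set δ : ℝ := ε / (2 * M) with hδ
  have hδ0 : 0 < δ := by positivity
  -- `F · y` is uniformly close to `Φ` on the compact set `K ∪ tsupport Φ`, for `y` near `y₀`.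
  have htube : ∀ᶠ y in 𝓝 y₀, ∀ x ∈ K ∪ tsupport Φ, p x = q y → ‖F x y - Φ x‖ ≤ δ := by
    refine hL.eventually_forall_of_forall_eventually fun x _ => ?_
    by_cases hx : p x = q y₀
    · have hc : ContinuousWithinAt (fun z : Y × X => ‖F z.2 z.1 - Φ z.2‖)
          {z | p z.2 = q z.1} (y₀, x) :=
        ((ContinuousWithinAt.comp (t := {z : X × Y | p z.1 = q z.2})
          (f := fun z : Y × X => (z.2, z.1)) (x := (y₀, x)) (hF (x, y₀) hx)
          (by fun_prop) fun z hz => hz).sub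
          (Φ.continuous.comp continuous_snd).continuousWithinAt).norm
      have h3 : ‖F x y₀ - Φ x‖ < δ := by
        rw [hΦ x hx]; simpa using hδ0
      have h4 := Filter.Tendsto.eventually_lt_const (u := δ) h3 hc
      rw [eventually_nhdsWithin_iff] at h4
      have h5 : ∀ᶠ z : Y × X in 𝓝 (y₀, x), p z.2 = q z.1 → ‖F z.2 z.1 - Φ z.2‖ ≤ δ := by
        filter_upwards [h4] with z hz hz' using (hz hz').le
      exact h5
    · have : IsOpen {z : Y × X | p z.2 ≠ q z.1} :=
        isOpen_ne_fun (hp.comp continuous_snd) (hq.comp continuous_fst)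
      have h5 : ∀ᶠ z : Y × X in 𝓝 (y₀, x), p z.2 = q z.1 → ‖F z.2 z.1 - Φ z.2‖ ≤ δ := by
        filter_upwards [this.mem_nhds hx] with z hz hz' using absurd hz' hz
      exact h5
  have hy₀ : ∫ x, F x y₀ ∂(ν (q y₀)) = ∫ x, Φ x ∂(ν (q y₀)) := by
    refine integral_congr_ae ?_
    filter_upwards [compl_mem_ae_iff.2 (hν0 (q y₀))] with x hx
    exact (hΦ x (not_not.1 hx)).symm
  filter_upwards [hMev, hlim, htube] with y hy1 hy2 hy3
  have hdiff : ‖∫ x, F x y ∂(ν (q y)) - ∫ x, Φ x ∂(ν (q y))‖ ≤ ε / 2 := by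
    rw [← integral_sub (integrable_of_continuousOn_fiber (hZ _) (hν0 _) (hFy y) hK
      fun x hx => h0 x y hx) Φ.integrable]
    calc _ ≤ ∫ x, δ * ψ x ∂(ν (q y)) := by
          refine norm_integral_le_of_norm_le (ψ.integrable.const_mul δ) ?_
          filter_upwards [compl_mem_ae_iff.2 (hν0 (q y))] with x hx
          have hx' : p x = q y := not_not.1 hx
          by_cases hxL : x ∈ K ∪ tsupport Φ
          · rw [h1 x hxL, mul_one]
            exact hy3 x hxL hx'
          · rw [h0 x y hx' fun h => hxL (Or.inl h),
              image_eq_zero_of_notMem_tsupport fun h => hxL (Or.inr h)]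
            simpa using mul_nonneg hδ0.le (h2 x)
      _ = δ * ∫ x, ψ x ∂(ν (q y)) := integral_const_mul _ _
      _ ≤ δ * M := by gcongr
      _ = ε / 2 := by rw [hδ]; field_simp
  rw [hy₀]
  calc _ ≤ dist (∫ x, F x y ∂(ν (q y))) (∫ x, Φ x ∂(ν (q y))) + _ := dist_triangle _ _ _
    _ < ε / 2 + ε / 2 := add_lt_add_of_le_of_lt (by rwa [dist_eq_norm]) hy2
    _ = ε := add_halves ε

/-- Density of `C_c(X)` in `L²`.  Mathlib has this under the additional assumption that `X` is
normal. -/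
theorem exists_cc_eLpNorm_sub_le {μ : Measure X} [μ.Regular] {f : X → ℂ} (hf : MemLp f 2 μ)
    {ε : ℝ≥0∞} (hε : ε ≠ 0) : ∃ g : C_c(X, ℂ), eLpNorm (f - ⇑g) 2 μ ≤ ε := by
  suffices H : ∃ g : X → ℂ, eLpNorm (f - g) 2 μ ≤ ε ∧ ∃ h : C_c(X, ℂ), g = ⇑h by
    obtain ⟨g, hg, h, rfl⟩ := H
    exact ⟨h, hg⟩
  refine hf.induction_dense (by simp) (fun g => ∃ h : C_c(X, ℂ), g = ⇑h) ?_ ?_ ?_ hε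
  · intro c t ht htμ ε hε
    obtain ⟨η, η0, hη⟩ := exists_eLpNorm_indicator_le (μ := μ) (p := 2) (by simp) c hε
    have hη2 : ((η / 2 : NNReal) : ℝ≥0∞) ≠ 0 := by simpa using η0.ne'
    obtain ⟨K, hKt, hK, hKc, hμK⟩ := ht.exists_isCompact_isClosed_sdiff_lt htμ.ne hη2
    have hKμ : μ K ≠ ∞ := hK.measure_ne_top
    obtain ⟨V, hKV, hV, -, hμV⟩ := hKc.measurableSet.exists_isOpen_sdiff_lt hKμ hη2
    obtain ⟨ψ, h1, h2, hc, h3⟩ := exists_continuous_one_zero_of_isCompact hK hV.isClosed_compl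
      (Set.disjoint_left.2 fun x hx hx' => hx' (hKV hx))
    refine ⟨_, ?_, ⟨⟨fun x => ψ x • c, by fun_prop⟩, hc.smul_right⟩, rfl⟩
    refine (eLpNorm_mono fun x => ?_).trans (hη (V \ K ∪ t \ K) ?_)
    · change ‖ψ x • c - t.indicator (fun _ => c) x‖ ≤ _
      by_cases hx : x ∈ V \ K ∪ t \ K
      · rw [Set.indicator_of_mem hx]
        obtain ⟨h4, h5⟩ := h3 x
        by_cases hxt : x ∈ t
        · rw [Set.indicator_of_mem hxt, ← neg_sub, norm_neg]
          have : c - ψ x • c = (1 - ψ x) • c := by rw [sub_smul, one_smul]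
          rw [this, norm_smul, Real.norm_of_nonneg (by linarith)]
          exact mul_le_of_le_one_left (norm_nonneg _) (by linarith)
        · rw [Set.indicator_of_notMem hxt, sub_zero, norm_smul, Real.norm_of_nonneg h4]
          exact mul_le_of_le_one_left (norm_nonneg _) h5
      · rw [Set.indicator_of_notMem hx, norm_zero, norm_le_zero_iff]
        by_cases hxK : x ∈ K
        · rw [Set.indicator_of_mem (hKt hxK), h1 hxK]
          simp
        · have hxV : x ∉ V := fun h => hx (Or.inl ⟨h, hxK⟩)
          have hxt : x ∉ t := fun h => hx (Or.inr ⟨h, hxK⟩)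
          rw [Set.indicator_of_notMem hxt, h2 hxV]
          simp
    · calc μ (V \ K ∪ t \ K) ≤ μ (V \ K) + μ (t \ K) := measure_union_le _ _
        _ ≤ ((η / 2 : NNReal) : ℝ≥0∞) + ((η / 2 : NNReal) : ℝ≥0∞) := add_le_add hμV.le hμK.le
        _ = η := by rw [← ENNReal.coe_add, add_halves]
  · rintro _ _ ⟨f, rfl⟩ ⟨g, rfl⟩
    exact ⟨f + g, rfl⟩
  · rintro _ ⟨f, rfl⟩
    exact f.continuous.aestronglyMeasurable

/-- Schur's test, for a continuous kernel on a closed set `Z` that carries the measure. -/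
theorem schur_test {μ : Measure X} [IsFiniteMeasureOnCompacts μ] {Z : Set X} (hZ : IsClosed Z)
    (hμ : μ Zᶜ = 0) {k : X → X → ℂ} (hk : ContinuousOn (Function.uncurry k) (Z ×ˢ Z))
    {h : X → ℂ} (hh : ContinuousOn h Z) {K L : Set X} (hK : IsCompact K) (hL : IsCompact L)
    (hhL : ∀ ξ ∈ Z, ξ ∉ L → h ξ = 0) (hkK : ∀ ζ ∈ Z, ∀ ξ ∈ Z, ξ ∈ L → ζ ∉ K → k ζ ξ = 0)
    (hki : ∀ ζ ∈ Z, Integrable (k ζ) μ) {C : ℝ}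
    (h1 : ∀ ζ ∈ Z, ∫ ξ, ‖k ζ ξ‖ ∂μ ≤ C) (h2 : ∀ ξ ∈ Z, ∫ ζ, ‖k ζ ξ‖ ∂μ ≤ C) :
    ∫ ζ, ‖∫ ξ, k ζ ξ * h ξ ∂μ‖ ^ 2 ∂μ ≤ C ^ 2 * ∫ ξ, ‖h ξ‖ ^ 2 ∂μ := by
  have hae : ∀ᵐ x ∂μ, x ∈ Z := by
    filter_upwards [compl_mem_ae_iff.2 hμ] with x hx using not_not.1 hx
  rcases Z.eq_empty_or_nonempty with rfl | ⟨z, hz⟩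
  · have : μ = 0 := by simpa using hμ
    simp [this]
  have hC : 0 ≤ C := (integral_nonneg fun _ => norm_nonneg _).trans (h1 z hz)
  have hhsnd : ContinuousOn (fun z : X × X => h z.2) (Z ×ˢ Z) :=
    hh.comp continuousOn_snd fun z hz => hz.2
  -- A function in `C_c(X × X)` allows Fubini's theorem without σ-finiteness.
  obtain ⟨Θ, hΘ⟩ := exists_cc_extension (E := ℝ) (hZ.prod hZ)
    (φ := fun z => ‖k z.1 z.2‖ * ‖h z.2‖ ^ 2) (hk.norm.mul (hhsnd.norm.pow 2))
    (hK.prod hL) (by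
      rintro ⟨ζ, ξ⟩ ⟨hζ, hξ⟩ hn
      by_cases hξL : ξ ∈ L
      · have : ζ ∉ K := fun hζK => hn ⟨hζK, hξL⟩
        simp [hkK ζ hζ ξ hξ hξL this]
      · simp [hhL ξ hξ hξL])
  have hkζ : ∀ ζ ∈ Z, ContinuousOn (k ζ) Z := fun ζ hζ =>
    hk.comp (f := fun ξ => (ζ, ξ)) (by fun_prop) fun ξ hξ => ⟨hζ, hξ⟩
  have hpt : ∀ ζ ∈ Z, ‖∫ ξ, k ζ ξ * h ξ ∂μ‖ ^ 2 ≤ C * ∫ ξ, Θ (ζ, ξ) ∂μ := by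
    intro ζ hζ
    have : ∫ ξ, Θ (ζ, ξ) ∂μ = ∫ ξ, ‖k ζ ξ‖ * ‖h ξ‖ ^ 2 ∂μ := by
      refine integral_congr_ae ?_
      filter_upwards [hae] with ξ hξ using hΘ (ζ, ξ) ⟨hζ, hξ⟩
    rw [this]
    refine norm_integral_mul_sq_le (hki ζ hζ) ?_ ?_ (h1 ζ hζ)
    · exact integrable_of_continuousOn_fiber hZ hμ ((hkζ ζ hζ).mul hh) hL
        fun ξ hξ hn => by simp [hhL ξ hξ hn]
    · exact integrable_of_continuousOn_fiber hZ hμ ((hkζ ζ hζ).norm.mul (hh.norm.pow 2)) hL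
        fun ξ hξ hn => by simp [hhL ξ hξ hn]
  have hΘi : Integrable (fun ζ => ∫ ξ, Θ (ζ, ξ) ∂μ) μ := by
    have hc1 : IsCompact (Prod.fst '' tsupport Θ) :=
      Θ.hasCompactSupport.isCompact.image continuous_fst
    have hc2 : IsCompact (Prod.snd '' tsupport Θ) :=
      Θ.hasCompactSupport.isCompact.image continuous_snd
    refine Continuous.integrable_of_hasCompactSupport ?_
      (HasCompactSupport.intro hc1 fun ζ hζ => ?_)
    · rw [← continuousOn_univ]
      refine continuousOn_integral_of_compact_support (f := fun ζ ξ => Θ (ζ, ξ)) hc2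
        Θ.continuous.continuousOn fun ζ ξ _ hξ => ?_
      exact image_eq_zero_of_notMem_tsupport fun hm => hξ ⟨_, hm, rfl⟩
    · have : ∀ ξ, Θ (ζ, ξ) = 0 := fun ξ =>
        image_eq_zero_of_notMem_tsupport fun hm => hζ ⟨_, hm, rfl⟩
      simp [this]
  calc ∫ ζ, ‖∫ ξ, k ζ ξ * h ξ ∂μ‖ ^ 2 ∂μ ≤ ∫ ζ, C * ∫ ξ, Θ (ζ, ξ) ∂μ ∂μ := by
        refine integral_mono_of_nonneg (Filter.Eventually.of_forall fun ζ => by positivity)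
          (hΘi.const_mul C) ?_
        filter_upwards [hae] with ζ hζ using hpt ζ hζ
    _ = C * ∫ ξ, ∫ ζ, Θ (ζ, ξ) ∂μ ∂μ := by
        rw [integral_const_mul, integral_integral_swap_of_hasCompactSupport
          (f := fun ζ ξ => Θ (ζ, ξ)) Θ.continuous Θ.hasCompactSupport]
    _ ≤ C * ∫ ξ, C * ‖h ξ‖ ^ 2 ∂μ := by
        refine mul_le_mul_of_nonneg_left ?_ hC
        refine integral_mono_of_nonneg ?_ ((integrable_of_continuousOn_fiber hZ hμ
          (hh.norm.pow 2) hL fun ξ hξ hn => by simp [hhL ξ hξ hn]).const_mul C) ?_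
        · filter_upwards [hae] with ξ hξ
          refine integral_nonneg_of_ae ?_
          filter_upwards [hae] with ζ hζ
          rw [hΘ (ζ, ξ) ⟨hζ, hξ⟩]
          change 0 ≤ _
          positivity
        · filter_upwards [hae] with ξ hξ
          have : ∫ ζ, Θ (ζ, ξ) ∂μ = ∫ ζ, ‖k ζ ξ‖ * ‖h ξ‖ ^ 2 ∂μ := by
            refine integral_congr_ae ?_
            filter_upwards [hae] with ζ hζ using hΘ (ζ, ξ) ⟨hζ, hξ⟩
          simp only [this, integral_mul_const]
          gcongr
          exact h2 ξ hξ
    _ = C ^ 2 * ∫ ξ, ‖h ξ‖ ^ 2 ∂μ := by rw [integral_const_mul]; ring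

end Analysis

/-! ### Groupoids, quotients by compact groups, and twists -/

open TopologicalGroupoid

section GroupoidBasics

variable {G H : Type*} [TopologicalSpace G] [TopologicalGroupoid G] [TopologicalSpace H]
  [TopologicalGroupoid H]

theorem s_eq_of_unit {x : G} (h : r x = x) : s x = x := by
  rw [← h, s_r]

theorem inv_inv' (x : G) : inv (inv x) = x := by
  have h1 : s (inv (inv x)) = r (inv x) := s_inv _
  calc inv (inv x) = mul (inv (inv x)) (s x) := by
        conv_lhs => rw [← mul_s_self (inv (inv x)), h1, r_inv]
    _ = mul (inv (inv x)) (mul (inv x) x) := by rw [inv_mul_self]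
    _ = mul (mul (inv (inv x)) (inv x)) x := (assoc _ _ _ h1 (s_inv x)).symm
    _ = x := by rw [inv_mul_self, s_inv, r_mul_self]

theorem inv_mul_cancel' {x y : G} (h : s x = r y) : mul (inv x) (mul x y) = y := by
  rw [← assoc _ _ _ (s_inv x) h, inv_mul_self, h, r_mul_self]

theorem mul_inv_cancel' {x y : G} (h : r x = r y) : mul x (mul (inv x) y) = y := by
  rw [← assoc _ _ _ (r_inv x).symm ((s_inv x).trans h), mul_inv_self, h, r_mul_self]

theorem mul_mul_inv {x y : G} (h : s x = r y) : mul (mul x y) (inv y) = x := by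
  rw [assoc _ _ _ h (r_inv y).symm, mul_inv_self, ← h, mul_s_self]

theorem eq_inv_of_mul_eq {a b : G} (h : s a = r b) (hab : mul a b = r a) : b = inv a := by
  rw [← inv_mul_cancel' h, hab, ← s_inv, mul_s_self]

theorem inv_mul' {x y : G} (h : s x = r y) : inv (mul x y) = mul (inv y) (inv x) := by
  have h1 : s (inv y) = r (inv x) := by rw [s_inv, r_inv, h]
  refine (eq_inv_of_mul_eq ?_ ?_).symm
  · rw [s_mul _ _ h, r_mul _ _ h1, r_inv]
  · rw [← assoc _ _ _ (by rw [s_mul _ _ h, r_inv]) h1, mul_mul_inv h, mul_inv_self, r_mul _ _ h]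

theorem continuous_gmul {X : Type*} [TopologicalSpace X] {f g : X → G} (hf : Continuous f)
    (hg : Continuous g) (h : ∀ x, s (f x) = r (g x)) : Continuous fun x => mul (f x) (g x) :=
  continuousOn_mul.comp_continuous (hf.prodMk hg) h

theorem continuousOn_gmul {X : Type*} [TopologicalSpace X] {f g : X → G} {Z : Set X}
    (hf : ContinuousOn f Z) (hg : ContinuousOn g Z) (h : ∀ x ∈ Z, s (f x) = r (g x)) :
    ContinuousOn (fun x => mul (f x) (g x)) Z :=
  continuousOn_mul.comp (hf.prodMk hg) h

theorem continuous_r : Continuous (r : G → G) := by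
  have h : (r : G → G) = fun x => mul x (inv x) := funext fun x => (mul_inv_self x).symm
  rw [h]
  exact continuous_gmul continuous_id continuous_inv fun x => (r_inv x).symm

theorem continuous_s : Continuous (s : G → G) := by
  have h : (s : G → G) = fun x => mul (inv x) x := funext fun x => (inv_mul_self x).symm
  rw [h]
  exact continuous_gmul continuous_inv continuous_id fun x => s_inv x

variable (G) in
/-- Inversion, as a homeomorphism. -/
def invHomeo : G ≃ₜ G where
  toFun := inv
  invFun := inv
  left_inv := inv_inv'
  right_inv := inv_inv'
  continuous_toFun := continuous_inv
  continuous_invFun := continuous_inv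

variable {φ : G → H}

theorem IsGroupoidHom.map_r (hφ : IsGroupoidHom φ) (x : G) : φ (r x) = r (φ x) := by
  have h1 := (hφ (r x) x (s_r x)).1
  have h2 : r (φ (r x)) = φ (r x) := hφ.mapsTo (r_r x)
  rw [← h1, s_eq_of_unit h2]

theorem IsGroupoidHom.map_s (hφ : IsGroupoidHom φ) (x : G) : φ (s x) = s (φ x) := by
  have h1 := (hφ x (s x) (r_s x).symm).1
  have h2 : r (φ (s x)) = φ (s x) := hφ.mapsTo (r_s x)
  rw [h1, h2]

theorem IsGroupoidHom.map_inv (hφ : IsGroupoidHom φ) (x : G) : φ (inv x) = inv (φ x) := by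
  obtain ⟨h1, h2⟩ := hφ x (inv x) (r_inv x).symm
  exact eq_inv_of_mul_eq h1 (by rw [← h2, mul_inv_self, hφ.map_r])

end GroupoidBasics

section CompactQuotient

variable {Γ X Y : Type*} [TopologicalSpace Γ] [TopologicalSpace X]
  [TopologicalSpace Y] {a : Γ → X → X} {q : X → Y}

theorem isOpenMap_of_orbits (ha : Continuous (Function.uncurry a)) (hq : IsQuotientMap q)
    (h : ∀ x y, q x = q y ↔ ∃ α, y = a α x) : IsOpenMap q := by
  intro U hU
  rw [← hq.isOpen_preimage]
  have : q ⁻¹' (q '' U) = ⋃ α, a α ⁻¹' U := by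
    ext x
    simp only [Set.mem_preimage, Set.mem_image, Set.mem_iUnion]
    constructor
    · rintro ⟨y, hy, hxy⟩
      obtain ⟨α, rfl⟩ := (h x y).1 hxy.symm
      exact ⟨α, hy⟩
    · rintro ⟨α, hα⟩
      exact ⟨_, hα, ((h _ _).2 ⟨α, rfl⟩).symm⟩
  rw [this]
  exact isOpen_iUnion fun α => hU.preimage (ha.comp (by fun_prop : Continuous fun x => (α, x)))

variable [CompactSpace Γ]

/-- A quotient map whose fibres are the orbits of a compact group is proper. -/
theorem isProperMap_of_orbits (ha : Continuous (Function.uncurry a)) (hq : IsQuotientMap q)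
    (h : ∀ x y, q x = q y ↔ ∃ α, y = a α x) : IsProperMap q := by
  rw [isProperMap_iff_isClosedMap_and_compact_fibers]
  refine ⟨hq.continuous, fun C hC => ?_, fun y => ?_⟩
  · rw [← hq.isClosed_preimage]
    have : q ⁻¹' (q '' C) = Prod.snd '' (Function.uncurry a ⁻¹' C) := by
      ext x
      simp only [Set.mem_preimage, Set.mem_image]
      constructor
      · rintro ⟨y, hy, hxy⟩
        obtain ⟨α, rfl⟩ := (h x y).1 hxy.symm
        exact ⟨(α, x), hy, rfl⟩
      · rintro ⟨⟨α, y⟩, hα, rfl⟩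
        exact ⟨_, hα, ((h _ _).2 ⟨α, rfl⟩).symm⟩
    rw [this]
    exact isClosedMap_snd_of_compactSpace _ (hC.preimage ha)
  · obtain ⟨x, rfl⟩ := hq.surjective y
    have : q ⁻¹' {q x} = Set.range fun α => a α x := by
      ext z
      simp only [Set.mem_preimage, Set.mem_singleton_iff, Set.mem_range]
      rw [eq_comm, h]
      exact exists_congr fun α => eq_comm
    rw [this]
    exact isCompact_range (ha.comp (by fun_prop : Continuous fun α => (α, x)))

theorem t2Space_of_orbits [T2Space X] (ha : Continuous (Function.uncurry a))
    (hq : IsQuotientMap q) (h : ∀ x y, q x = q y ↔ ∃ α, y = a α x) : T2Space Y := by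
  rw [t2Space_iff_of_isOpenQuotientMap
    ⟨hq.surjective, hq.continuous, isOpenMap_of_orbits ha hq h⟩]
  have : {p : X × X | q p.1 = q p.2} =
      Prod.snd '' {z : Γ × (X × X) | z.2.2 = a z.1 z.2.1} := by
    ext ⟨x, y⟩
    simp [h]
  rw [this]
  refine isClosedMap_snd_of_compactSpace _ (isClosed_eq (by fun_prop) ?_)
  exact ha.comp (by fun_prop : Continuous fun z : Γ × (X × X) => (z.1, z.2.1))

end CompactQuotient

namespace Twist

section TwistBasics

variable {Γ : Type w} {G : Type u} {S : Type v} [CommGroup Γ] [TopologicalSpace Γ]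
  [IsTopologicalGroup Γ] [TopologicalSpace G] [TopologicalGroupoid G]
  [TopologicalSpace S] [TopologicalGroupoid S] (T : Twist Γ G S)

theorem continuous_π : Continuous T.π := T.isQuotientMap_π.continuous

theorem continuous_base : Continuous T.base :=
  (T.continuous_π.comp continuous_r).subtype_mk _

theorem r_ι (u : units G) (α : Γ) : r (T.ι (u, α)) = T.ι (u, 1) :=
  (T.hom_ι.map_r (u, α)).symm

theorem s_ι (u : units G) (α : Γ) : s (T.ι (u, α)) = T.ι (u, 1) :=
  (T.hom_ι.map_s (u, α)).symm

theorem ι_mul (u : units G) (α β : Γ) : mul (T.ι (u, α)) (T.ι (u, β)) = T.ι (u, α * β) :=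
  (T.hom_ι (u, α) (u, β) rfl).2.symm

theorem ι_base_one (σ : S) : T.ι (T.base σ, 1) = r σ := by
  rw [← T.s_ι _ 1]
  exact (T.central σ 1).1

theorem coe_base (σ : S) : (T.base σ : G) = r (T.π σ) := T.hom_π.map_r σ

theorem base_eq_rng (σ : S) : T.base σ = rng (T.π σ) := Subtype.ext (T.coe_base σ)

theorem π_ι (u : units G) (α : Γ) : T.π (T.ι (u, α)) = u := by
  have h1 : T.π (T.ι (u, α)) ∈ units G := by
    have : T.ι (u, α) ∈ Set.range T.ι := ⟨_, rfl⟩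
    rwa [T.exact] at this
  have h2 : T.ι (T.base (T.ι (u, α)), 1) = T.ι (u, 1) := by rw [ι_base_one, r_ι]
  have h3 : T.base (T.ι (u, α)) = u := congrArg Prod.fst (T.isEmbedding_ι.injective h2)
  have h4 := T.coe_base (T.ι (u, α))
  rw [h3] at h4
  rw [h4]
  exact h1.symm

theorem base_ι (u : units G) (α : Γ) : T.base (T.ι (u, α)) = u := by
  apply Subtype.ext
  rw [coe_base, π_ι]
  exact u.2

theorem base_eq_iff {σ τ : S} : T.base σ = T.base τ ↔ r σ = r τ := by
  constructor
  · intro h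
    rw [← T.ι_base_one, h, ι_base_one]
  · intro h
    apply Subtype.ext
    change T.π (r σ) = T.π (r τ)
    rw [h]

theorem composable_iff {σ τ : S} : s σ = r τ ↔ T.base (inv σ) = T.base τ := by
  rw [base_eq_iff, r_inv]

theorem s_ι_base (σ : S) (α : Γ) : s (T.ι (T.base σ, α)) = r σ := by
  rw [s_ι, ι_base_one]

theorem r_act (α : Γ) (σ : S) : r (T.act α σ) = r σ := by
  rw [act, r_mul _ _ (T.s_ι_base σ α), r_ι, ι_base_one]

theorem s_act (α : Γ) (σ : S) : s (T.act α σ) = s σ := by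
  rw [act, s_mul _ _ (T.s_ι_base σ α)]

theorem base_act (α : Γ) (σ : S) : T.base (T.act α σ) = T.base σ :=
  T.base_eq_iff.2 (T.r_act α σ)

theorem act_one (σ : S) : T.act 1 σ = σ := by
  rw [act, ι_base_one, r_mul_self]

theorem act_act (α β : Γ) (σ : S) : T.act α (T.act β σ) = T.act (α * β) σ := by
  conv_lhs => rw [act, base_act, act]
  rw [← assoc _ _ _ (by rw [s_ι, r_ι]) (T.s_ι_base σ β), ι_mul, act]

theorem act_eq_mul_ι (α : Γ) (σ : S) : T.act α σ = mul σ (T.ι (T.base (inv σ), α)) := by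
  rw [act]
  refine (T.central σ α).2.2.trans ?_
  congr 3
  apply Subtype.ext
  change _ = T.π (r (inv σ))
  rw [r_inv]

theorem act_mul (α : Γ) {σ τ : S} (h : s σ = r τ) :
    mul (T.act α σ) τ = T.act α (mul σ τ) := by
  rw [act, act, assoc _ _ _ (T.s_ι_base σ α) h, T.base_eq_iff.2 (r_mul σ τ h)]

theorem mul_act (α : Γ) {σ τ : S} (h : s σ = r τ) :
    mul σ (T.act α τ) = T.act α (mul σ τ) := by
  have h1 : T.base (inv (mul σ τ)) = T.base (inv τ) :=
    T.base_eq_iff.2 (by rw [r_inv, r_inv, s_mul _ _ h])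
  rw [act_eq_mul_ι, act_eq_mul_ι, h1,
    assoc _ _ _ h (by rw [r_ι, ι_base_one, r_inv])]

theorem inv_act (α : Γ) (σ : S) : inv (T.act α σ) = T.act α⁻¹ (inv σ) := by
  have h : s σ = r (inv σ) := (r_inv σ).symm
  refine (eq_inv_of_mul_eq (by rw [s_act, r_act, h]) ?_).symm
  rw [act_mul _ _ (by rw [r_act, h]), mul_act _ _ h, act_act, mul_inv_cancel, act_one,
    mul_inv_self, r_act]

theorem π_act (α : Γ) (σ : S) : T.π (T.act α σ) = T.π σ := by
  rw [act, (T.hom_π _ _ (T.s_ι_base σ α)).2, π_ι, coe_base, r_mul_self]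

/-- The fibres of `π` are `Γ`-orbits: if `π σ = π τ`, then `τ σ⁻¹` lies in the kernel of `π`, which
is the image of `ι`. -/
theorem exists_act_of_π_eq {σ τ : S} (h : T.π σ = T.π τ) : ∃ α, τ = T.act α σ := by
  have hs : s τ = s σ := by
    have h1 : T.base (inv τ) = T.base (inv σ) := by
      apply Subtype.ext
      rw [coe_base, coe_base, T.hom_π.map_inv, T.hom_π.map_inv, h]
    have h2 := T.base_eq_iff.1 h1
    rwa [r_inv, r_inv] at h2
  have hc : s τ = r (inv σ) := by rw [hs, r_inv]
  have hmem : mul τ (inv σ) ∈ T.π ⁻¹' units G := by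
    change r (T.π (mul τ (inv σ))) = T.π (mul τ (inv σ))
    rw [(T.hom_π _ _ hc).2, T.hom_π.map_inv, h, mul_inv_self, r_r]
  rw [← T.exact] at hmem
  obtain ⟨⟨u, α⟩, hu⟩ := hmem
  refine ⟨α, ?_⟩
  have h3 : mul (mul τ (inv σ)) σ = τ := by
    rw [assoc _ _ _ hc (s_inv σ), inv_mul_self, ← hs, mul_s_self]
  have hu' : u = T.base σ := by
    have h4 : r (T.ι (u, α)) = r σ := by
      have h5 : s (T.ι (u, α)) = r σ := by rw [hu, s_mul _ _ hc, s_inv]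
      rw [r_ι, ← T.s_ι u α, h5]
    rw [← T.base_ι u α]
    exact T.base_eq_iff.2 h4
  rw [← h3, ← hu, hu', act]

theorem π_eq_iff (σ τ : S) : T.π σ = T.π τ ↔ ∃ α, τ = T.act α σ :=
  ⟨T.exists_act_of_π_eq, by rintro ⟨α, rfl⟩; exact (T.π_act α σ).symm⟩

theorem continuous_act : Continuous (Function.uncurry T.act) :=
  continuous_gmul (f := fun p : Γ × S => T.ι (T.base p.2, p.1)) (g := Prod.snd)
    (T.isEmbedding_ι.continuous.comp
      ((T.continuous_base.comp continuous_snd).prodMk continuous_fst))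
    continuous_snd fun p => T.s_ι_base p.2 p.1

theorem continuous_act_left (σ : S) : Continuous fun α => T.act α σ :=
  T.continuous_act.comp (by fun_prop : Continuous fun α => (α, σ))

theorem continuous_orbit (f : C_c(S, ℂ)) (σ : S) : Continuous fun α => f (T.act α σ) :=
  f.continuous.comp (T.continuous_act_left σ)

theorem base_inv_eq_src (σ : S) : T.base (inv σ) = src (T.π σ) := by
  rw [base_eq_rng, T.hom_π.map_inv]
  exact Subtype.ext (r_inv _)

theorem isClosed_fiber [T2Space G] (u : units G) : IsClosed {σ | T.base σ = u} :=
  isClosed_eq T.continuous_base continuous_const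

theorem isProperMap_π [CompactSpace Γ] : IsProperMap T.π :=
  isProperMap_of_orbits T.continuous_act T.isQuotientMap_π T.π_eq_iff

theorem π_sec (γ : G) : T.π (T.sec γ) = γ := Function.surjInv_eq _ γ

theorem composable_inv {σ τ : S} (h : T.base τ = T.base σ) : s (inv τ) = r σ := by
  rw [s_inv]; exact T.base_eq_iff.1 h

/-- The integrand of a convolution of equivariant functions is constant on `Γ`-orbits. -/
theorem conv_integrand_act {χ : Γ →ₜ* Circle} {f g : C_c(S, ℂ)} (hf : f ∈ T.equivariantCc χ)
    (hg : g ∈ T.equivariantCc χ) {σ τ : S} (h : T.base τ = T.base σ) (α : Γ) :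
    f (T.act α τ) * g (mul (inv (T.act α τ)) σ) = f τ * g (mul (inv τ) σ) := by
  rw [inv_act, T.act_mul _ (T.composable_inv h), hf α, hg α⁻¹, map_inv, Circle.coe_inv]
  field_simp [Circle.coe_ne_zero]

end TwistBasics

end Twist

/-! ### Orbit averages and the induced Haar system -/

/-- As a local instance, together with `borel`, this lets the measures of the definitions, which
live on Borel σ-algebras, be used with the type-class based library. -/
theorem borelSpace_borel (X : Type*) [TopologicalSpace X] : @BorelSpace X _ (borel X) :=
  @BorelSpace.mk X _ (borel X) rfl

attribute [local instance 10] borel borelSpace_borel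

section NormHaar

variable (Γ : Type w) [CommGroup Γ] [TopologicalSpace Γ] [IsTopologicalGroup Γ] [CompactSpace Γ]

instance : @Measure.IsHaarMeasure Γ _ _ (borel Γ) (normHaar Γ) := by
  unfold normHaar
  infer_instance

instance : IsProbabilityMeasure (normHaar Γ) :=
  ⟨Measure.haarMeasure_self (K₀ := (⊤ : TopologicalSpace.PositiveCompacts Γ))⟩

variable {Γ}

theorem integral_normHaar_mul_left {E : Type*} [NormedAddCommGroup E] [NormedSpace ℝ E]
    (f : Γ → E) (β : Γ) : ∫ α, f (β * α) ∂(normHaar Γ) = ∫ α, f α ∂(normHaar Γ) :=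
  integral_mul_left_eq_self f β

theorem integrable_normHaar {E : Type*} [NormedAddCommGroup E] {f : Γ → E} (hf : Continuous f) :
    Integrable f (normHaar Γ) :=
  hf.integrable_of_hasCompactSupport (HasCompactSupport.of_compactSpace f)

theorem continuous_integral_normHaar {X : Type*} [TopologicalSpace X] {F : X → Γ → ℂ}
    (hF : Continuous (Function.uncurry F)) : Continuous fun x => ∫ α, F x α ∂(normHaar Γ) := by
  rw [← continuousOn_univ]
  exact continuousOn_integral_of_compact_support isCompact_univ hF.continuousOn
    fun _ α _ h => absurd (Set.mem_univ α) h

end NormHaar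

section HaarSystem

variable {G : Type u} [TopologicalSpace G] [TopologicalGroupoid G] (lam : HaarSystem G)

instance (u : units G) : (lam.meas u).Regular := lam.regular u

theorem HaarSystem.ae_rng (u : units G) : ∀ᵐ γ ∂(lam.meas u), rng γ = u := by
  have h : lam.meas u (lam.meas u).supportᶜ = 0 := Measure.measure_compl_support_of_regular
  rw [lam.support_eq] at h
  filter_upwards [compl_mem_ae_iff.2 h] with γ hγ
  exact Subtype.ext (not_not.1 hγ)

end HaarSystem

namespace Twist

variable {Γ : Type w} {G : Type u} {S : Type v} [CommGroup Γ] [TopologicalSpace Γ]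
  [IsTopologicalGroup Γ] [CompactSpace Γ] [TopologicalSpace G] [TopologicalGroupoid G]
  [TopologicalSpace S] [TopologicalGroupoid S] (T : Twist Γ G S)

/-- The average of `f` over the `Γ`-orbit in `S` that lies above `γ`. -/
noncomputable def avg (f : S → ℂ) (γ : G) : ℂ := ∫ α, f (T.act α (T.sec γ)) ∂(normHaar Γ)

/-- The average does not depend on the section of `π`, by invariance of Haar measure. -/
theorem avg_π (f : S → ℂ) (σ : S) : T.avg f (T.π σ) = ∫ α, f (T.act α σ) ∂(normHaar Γ) := by
  obtain ⟨β, hβ⟩ := T.exists_act_of_π_eq (T.π_sec (T.π σ)).symm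
  rw [avg, hβ]
  simp_rw [act_act, mul_comm _ β]
  exact integral_normHaar_mul_left (fun α => f (T.act α σ)) β

theorem avg_π_of_invariant {f : S → ℂ} {σ : S} (hf : ∀ α, f (T.act α σ) = f σ) :
    T.avg f (T.π σ) = f σ := by
  simp [avg_π, hf]

theorem avg_congr {f g : S → ℂ} {u : units G} (h : ∀ σ, T.base σ = u → f σ = g σ) {γ : G}
    (hγ : rng γ = u) : T.avg f γ = T.avg g γ := by
  refine integral_congr_ae (Filter.Eventually.of_forall fun α => h _ ?_)
  rw [base_act, base_eq_rng, π_sec, hγ]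

variable [T2Space G]

/-- The average of `f ∈ C_c(S)` over the fibres of `π`, as an element of `C_c(G)`. -/
noncomputable def avgCc (f : C_c(S, ℂ)) : C_c(G, ℂ) where
  toFun := T.avg f
  continuous_toFun := by
    rw [T.isQuotientMap_π.continuous_iff]
    have : T.avg f ∘ T.π = fun σ => ∫ α, f (T.act α σ) ∂(normHaar Γ) := funext fun σ => T.avg_π f σ
    rw [this]
    exact continuous_integral_normHaar (f.continuous.comp (T.continuous_act.comp continuous_swap))
  hasCompactSupport' := by
    refine HasCompactSupport.intro (f.hasCompactSupport.isCompact.image T.continuous_π)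
      fun γ hγ => ?_
    have : ∀ α, f (T.act α (T.sec γ)) = 0 := fun α =>
      image_eq_zero_of_notMem_tsupport fun h => hγ ⟨_, h, by rw [π_act, π_sec]⟩
    simp [avg, this]

theorem avgCc_apply (f : C_c(S, ℂ)) (γ : G) : T.avgCc f γ = T.avg f γ := rfl

variable [T2Space S] [LocallyCompactSpace S] (lam : HaarSystem G)

/-- The measure `μ^u` exists, by the Riesz representation theorem; so its definition by
`Classical.epsilon` has the intended meaning. -/
theorem exists_inducedMeasure (u : units G) : ∃ μ, T.IsInducedMeasure lam u μ := by
  let j : C_c(S, ℝ) → C_c(S, ℂ) := fun f =>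
    f.compLeft ⟨fun t : ℝ => (t : ℂ), Complex.continuous_ofReal⟩
  have hj : ∀ (f : C_c(S, ℝ)) σ, j f σ = (f σ : ℂ) := fun f σ =>
    CompactlySupportedContinuousMap.compLeft_apply Complex.ofReal_zero f σ
  have havg : ∀ (f : C_c(S, ℝ)) γ, T.avgCc (j f) γ =
      ((∫ α, f (T.act α (T.sec γ)) ∂(normHaar Γ) : ℝ) : ℂ) := by
    intro f γ
    rw [avgCc_apply, avg, ← integral_complex_ofReal]
    simp_rw [hj]
  have hint : ∀ (f : C_c(S, ℝ)) γ, Integrable (fun α => f (T.act α (T.sec γ))) (normHaar Γ) :=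
    fun f γ => integrable_normHaar (f.continuous.comp (T.continuous_act_left _))
  have hint' : ∀ f : C_c(S, ℝ), Integrable
      (fun γ => ∫ α, f (T.act α (T.sec γ)) ∂(normHaar Γ)) (lam.meas u) := by
    intro f
    have := ((T.avgCc (j f)).integrable (μ := lam.meas u)).re
    refine this.congr (Filter.Eventually.of_forall fun γ => ?_)
    simp [havg]
  let Λ : C_c(S, ℝ) →ₚ[ℝ] ℝ := PositiveLinearMap.mk₀
    { toFun := fun f => ∫ γ, (∫ α, f (T.act α (T.sec γ)) ∂(normHaar Γ)) ∂(lam.meas u)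
      map_add' := by
        intro f g
        rw [← integral_add (hint' f) (hint' g)]
        congr 1 with γ
        rw [← integral_add (hint f γ) (hint g γ)]
        rfl
      map_smul' := by
        intro c f
        simp [integral_const_mul] }
    fun f hf => integral_nonneg fun γ => integral_nonneg fun α => hf _
  have hΛ : ∀ f : C_c(S, ℝ), ∫ σ, f σ ∂(RealRMK.rieszMeasure Λ) =
      ∫ γ, (∫ α, f (T.act α (T.sec γ)) ∂(normHaar Γ)) ∂(lam.meas u) :=
    fun f => RealRMK.integral_rieszMeasure Λ f
  refine ⟨RealRMK.rieszMeasure Λ, RealRMK.regular_rieszMeasure Λ, fun f => ?_⟩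
  let fr : C_c(S, ℝ) := f.compLeft ⟨Complex.re, Complex.continuous_re⟩
  let fi : C_c(S, ℝ) := f.compLeft ⟨Complex.im, Complex.continuous_im⟩
  have hfr : ∀ σ, fr σ = (f σ).re :=
    CompactlySupportedContinuousMap.compLeft_apply Complex.zero_re f
  have hfi : ∀ σ, fi σ = (f σ).im :=
    CompactlySupportedContinuousMap.compLeft_apply Complex.zero_im f
  rw [← integral_re_add_im f.integrable, ← integral_re_add_im (𝕜 := ℂ)
    (f := fun γ => ∫ α, f (T.act α (T.sec γ)) ∂(normHaar Γ)) (T.avgCc f).integrable]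
  have e1 : ∀ γ, RCLike.re (∫ α, f (T.act α (T.sec γ)) ∂(normHaar Γ)) =
      ∫ α, fr (T.act α (T.sec γ)) ∂(normHaar Γ) := by
    intro γ
    simp_rw [hfr]
    exact (integral_re (integrable_normHaar (T.continuous_orbit f _))).symm
  have e2 : ∀ γ, RCLike.im (∫ α, f (T.act α (T.sec γ)) ∂(normHaar Γ)) =
      ∫ α, fi (T.act α (T.sec γ)) ∂(normHaar Γ) := by
    intro γ
    simp_rw [hfi]
    exact (integral_im (integrable_normHaar (T.continuous_orbit f _))).symm
  simp_rw [e1, e2, ← hΛ, hfr, hfi]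
  rfl

theorem haar_spec (u : units G) : T.IsInducedMeasure lam u (T.haar lam u) :=
  Classical.epsilon_spec (T.exists_inducedMeasure lam u)

instance regular_haar (u : units G) : (T.haar lam u).Regular := (T.haar_spec lam u).1

theorem integral_haar (u : units G) (f : C_c(S, ℂ)) :
    ∫ σ, f σ ∂(T.haar lam u) = ∫ γ, T.avg f γ ∂(lam.meas u) :=
  (T.haar_spec lam u).2 f

theorem haar_compl_fiber (u : units G) : T.haar lam u {σ | T.base σ = u}ᶜ = 0 := by
  refine measure_compl_eq_zero_of_integral (T.isClosed_fiber u) fun φ hφ => ?_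
  rw [integral_haar]
  refine integral_eq_zero_of_ae ?_
  filter_upwards [lam.ae_rng u] with γ hγ
  rw [T.avg_congr (g := fun _ => 0) hφ hγ]
  simp [avg]

theorem ae_base (u : units G) : ∀ᵐ σ ∂(T.haar lam u), T.base σ = u := by
  filter_upwards [compl_mem_ae_iff.2 (T.haar_compl_fiber lam u)] with σ hσ using not_not.1 hσ

/-- The defining formula of `μ^u` for functions that are continuous with compact support on the
fibre `S^u` only. -/
theorem integral_haar_fiber {u : units G} {φ : S → ℂ} (hφ : ContinuousOn φ {σ | T.base σ = u})
    {K : Set S} (hK : IsCompact K) (h0 : ∀ σ, T.base σ = u → σ ∉ K → φ σ = 0) :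
    ∫ σ, φ σ ∂(T.haar lam u) = ∫ γ, T.avg φ γ ∂(lam.meas u) := by
  obtain ⟨Φ, hΦ⟩ := exists_cc_extension (T.isClosed_fiber u) hφ hK h0
  calc ∫ σ, φ σ ∂(T.haar lam u) = ∫ σ, Φ σ ∂(T.haar lam u) := by
        refine integral_congr_ae ?_
        filter_upwards [T.ae_base lam u] with σ hσ using (hΦ σ hσ).symm
    _ = ∫ γ, T.avg Φ γ ∂(lam.meas u) := T.integral_haar lam u Φ
    _ = _ := by
        refine integral_congr_ae ?_
        filter_upwards [lam.ae_rng u] with γ hγ using T.avg_congr hΦ hγ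

theorem continuous_integral_haar (f : C_c(S, ℂ)) :
    Continuous fun u => ∫ σ, f σ ∂(T.haar lam u) := by
  simp_rw [integral_haar]
  exact lam.continuous_integral (T.avgCc f)

/-- Left invariance of the induced Haar system on `S`. -/
theorem integral_haar_mul_left (σ : S) {φ : S → ℂ}
    (hφ : ContinuousOn φ {τ | T.base τ = T.base σ}) {K : Set S} (hK : IsCompact K)
    (h0 : ∀ τ, T.base τ = T.base σ → τ ∉ K → φ τ = 0) :
    ∫ τ, φ (mul σ τ) ∂(T.haar lam (T.base (inv σ))) = ∫ τ, φ τ ∂(T.haar lam (T.base σ)) := by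
  obtain ⟨Φ, hΦ⟩ := exists_cc_extension (T.isClosed_fiber (T.base σ)) hφ hK h0
  have hbase : ∀ τ, T.base τ = T.base (inv σ) → T.base (mul σ τ) = T.base σ := fun τ hτ =>
    T.base_eq_iff.2 (r_mul _ _ (T.composable_iff.2 hτ.symm))
  have hcont : ContinuousOn (fun τ => Φ (mul σ τ)) {τ | T.base τ = T.base (inv σ)} :=
    Φ.continuous.comp_continuousOn (continuousOn_gmul continuousOn_const continuousOn_id
      fun τ hτ => T.composable_iff.2 (Eq.symm hτ))
  have hK' : IsCompact ((fun τ => mul (inv σ) τ) '' (tsupport Φ ∩ {τ | T.base τ = T.base σ})) := by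
    refine (Φ.hasCompactSupport.isCompact.inter_right (T.isClosed_fiber _)).image_of_continuousOn ?_
    refine continuousOn_gmul continuousOn_const continuousOn_id fun τ hτ => ?_
    rw [s_inv]
    exact T.base_eq_iff.1 hτ.2.symm
  calc ∫ τ, φ (mul σ τ) ∂(T.haar lam (T.base (inv σ)))
      = ∫ τ, Φ (mul σ τ) ∂(T.haar lam (T.base (inv σ))) := by
        refine integral_congr_ae ?_
        filter_upwards [T.ae_base lam _] with τ hτ using (hΦ _ (hbase τ hτ)).symm
    _ = ∫ γ, T.avg (fun τ => Φ (mul σ τ)) γ ∂(lam.meas (T.base (inv σ))) := by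
        refine T.integral_haar_fiber lam hcont hK' fun τ hτ hn => ?_
        refine image_eq_zero_of_notMem_tsupport fun h => hn ⟨_, ⟨h, hbase τ hτ⟩, ?_⟩
        exact inv_mul_cancel' (T.composable_iff.2 hτ.symm)
    _ = ∫ γ, T.avgCc Φ (mul (T.π σ) γ) ∂(lam.meas (src (T.π σ))) := by
        rw [base_inv_eq_src]
        refine integral_congr_ae ?_
        filter_upwards [lam.ae_rng _] with γ hγ
        obtain ⟨τ, rfl⟩ := T.isQuotientMap_π.surjective γ
        have hc : s σ = r τ := T.composable_iff.2 (by rw [base_inv_eq_src, base_eq_rng, hγ])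
        rw [avg_π, avgCc_apply, ← (T.hom_π _ _ hc).2, avg_π]
        simp_rw [T.mul_act _ hc]
    _ = ∫ γ, T.avgCc Φ γ ∂(lam.meas (T.base σ)) := by
        rw [lam.left_invariant, base_eq_rng]
    _ = ∫ τ, Φ τ ∂(T.haar lam (T.base σ)) := (T.integral_haar lam _ Φ).symm
    _ = _ := by
        refine integral_congr_ae ?_
        filter_upwards [T.ae_base lam _] with τ hτ using hΦ τ hτ

theorem integral_norm_haar_mul_left (σ : S) {φ : S → ℂ}
    (hφ : ContinuousOn φ {τ | T.base τ = T.base σ}) {K : Set S} (hK : IsCompact K)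
    (h0 : ∀ τ, T.base τ = T.base σ → τ ∉ K → φ τ = 0) :
    ∫ τ, ‖φ (mul σ τ)‖ ∂(T.haar lam (T.base (inv σ))) = ∫ τ, ‖φ τ‖ ∂(T.haar lam (T.base σ)) := by
  have h := T.integral_haar_mul_left lam σ (φ := fun τ => (‖φ τ‖ : ℂ))
    (Complex.continuous_ofReal.comp_continuousOn hφ.norm) hK
    (fun τ hτ hn => by simp [h0 τ hτ hn])
  rw [integral_complex_ofReal, integral_complex_ofReal] at h
  exact_mod_cast h

/-- The function `σ ↦ ‖f σ‖`, as a complex-valued function of compact support. -/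
noncomputable def absCc (f : C_c(S, ℂ)) : C_c(S, ℂ) :=
  f.compLeft ⟨fun z : ℂ => (‖z‖ : ℂ), by fun_prop⟩

/-- The function `σ ↦ f (σ⁻¹)`. -/
noncomputable def invCc (f : C_c(S, ℂ)) : C_c(S, ℂ) where
  toFun σ := f (inv σ)
  continuous_toFun := f.continuous.comp continuous_inv
  hasCompactSupport' := f.hasCompactSupport.comp_homeomorph (invHomeo S)

end Twist

theorem Twist.absCc_apply {S : Type v} [TopologicalSpace S] (f : C_c(S, ℂ)) (σ : S) :
    Twist.absCc f σ = (‖f σ‖ : ℂ) :=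
  CompactlySupportedContinuousMap.compLeft_apply (by simp) f σ

/-! ### Convolution and the isotypic projection -/

theorem continuous_coe_char {Γ : Type*} [CommGroup Γ] [TopologicalSpace Γ] (χ : Γ →ₜ* Circle) :
    Continuous fun α => (χ α : ℂ) :=
  continuous_subtype_val.comp (map_continuous χ)

namespace Twist

variable {Γ : Type w} {G : Type u} {S : Type v} [CommGroup Γ] [TopologicalSpace Γ]
  [IsTopologicalGroup Γ] [CompactSpace Γ] [TopologicalSpace G] [TopologicalGroupoid G]
  [TopologicalSpace S] [TopologicalGroupoid S] (T : Twist Γ G S) (lam : HaarSystem G)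

theorem integral_haarInv {E : Type*} [NormedAddCommGroup E] [NormedSpace ℝ E] (u : units G)
    (φ : S → E) : ∫ σ, φ σ ∂(T.haarInv lam u) = ∫ σ, φ (inv σ) ∂(T.haar lam u) :=
  (invHomeo S).measurableEmbedding.integral_map φ

theorem lintegral_haarInv (u : units G) (φ : S → ℝ≥0∞) :
    ∫⁻ σ, φ σ ∂(T.haarInv lam u) = ∫⁻ σ, φ (inv σ) ∂(T.haar lam u) :=
  (invHomeo S).measurableEmbedding.lintegral_map φ

variable [T2Space S]

section Projection

variable (χ : Γ →ₜ* Circle)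

/-- The projection of `C_c(S)` onto the `χ`-isotypic part `C_c(S; G; χ)`. -/
noncomputable def proj : C_c(S, ℂ) →ₗ[ℂ] T.equivariantCc χ where
  toFun g := ⟨{
    toFun := fun σ => ∫ α, (χ α : ℂ) * g (T.act α⁻¹ σ) ∂(normHaar Γ)
    continuous_toFun := by
      refine continuous_integral_normHaar (F := fun σ α => (χ α : ℂ) * g (T.act α⁻¹ σ)) ?_
      exact ((continuous_coe_char χ).comp continuous_snd).mul (g.continuous.comp
        (T.continuous_act.comp (continuous_snd.inv.prodMk continuous_fst)))
    hasCompactSupport' := by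
      refine HasCompactSupport.intro (T.isProperMap_π.isCompact_preimage
        (g.hasCompactSupport.isCompact.image T.continuous_π)) fun σ hσ => ?_
      have : ∀ α, g (T.act α⁻¹ σ) = 0 := fun α =>
        image_eq_zero_of_notMem_tsupport fun h => hσ ⟨_, h, T.π_act _ _⟩
      simp [this] }, by
    intro β σ
    change ∫ α, (χ α : ℂ) * g (T.act α⁻¹ (T.act β σ)) ∂(normHaar Γ) =
      χ β * ∫ α, (χ α : ℂ) * g (T.act α⁻¹ σ) ∂(normHaar Γ)
    rw [← integral_normHaar_mul_left _ β, ← integral_const_mul]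
    congr 1 with α
    rw [act_act, map_mul, Circle.coe_mul, mul_inv_rev, inv_mul_cancel_right, mul_assoc]⟩
  map_add' f g := by
    ext σ
    have h : ∀ f : C_c(S, ℂ), Integrable (fun α => (χ α : ℂ) * f (T.act α⁻¹ σ)) (normHaar Γ) :=
      fun f => integrable_normHaar ((continuous_coe_char χ).mul
        (f.continuous.comp ((T.continuous_act_left σ).comp continuous_inv)))
    refine Eq.trans ?_ (integral_add (h f) (h g))
    exact integral_congr_ae (Filter.Eventually.of_forall fun α => mul_add _ _ _)
  map_smul' c f := by
    ext σ
    refine Eq.trans ?_ (integral_const_mul c _)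
    refine integral_congr_ae (Filter.Eventually.of_forall fun α => ?_)
    change (χ α : ℂ) * (c * f _) = _
    ring

theorem proj_apply (g : C_c(S, ℂ)) (σ : S) :
    (T.proj χ g).1 σ = ∫ α, (χ α : ℂ) * g (T.act α⁻¹ σ) ∂(normHaar Γ) := rfl

theorem proj_of_mem (f : T.equivariantCc χ) : T.proj χ f.1 = f := by
  ext σ
  rw [proj_apply]
  have : ∀ α, (χ α : ℂ) * f.1 (T.act α⁻¹ σ) = f.1 σ := by
    intro α
    rw [f.2 α⁻¹ σ, map_inv, Circle.coe_inv, mul_inv_cancel_left₀ (Circle.coe_ne_zero _)]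
  simp [this]

end Projection

variable [T2Space G] [LocallyCompactSpace S]

theorem continuous_conv (f g : C_c(S, ℂ)) : Continuous (T.conv lam f g) := by
  refine continuous_integral_fiber (F := fun τ σ => f τ * g (mul (inv τ) σ)) T.continuous_base
    T.continuous_base (T.haar_compl_fiber lam) (T.continuous_integral_haar lam) ?_
    f.hasCompactSupport.isCompact ?_
  · refine (f.continuous.comp continuous_fst).continuousOn.mul
      (g.continuous.comp_continuousOn (continuousOn_gmul
        (TopologicalGroupoid.continuous_inv.comp continuous_fst).continuousOn
        continuous_snd.continuousOn ?_))
    exact fun z hz => T.composable_inv hz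
  · intro τ σ _ hτ
    rw [image_eq_zero_of_notMem_tsupport hτ, zero_mul]

/-- The convolution of two functions in `C_c(S)`, as an element of `C_c(S)`. -/
noncomputable def convCc (f g : C_c(S, ℂ)) : C_c(S, ℂ) where
  toFun := T.conv lam f g
  continuous_toFun := T.continuous_conv lam f g
  hasCompactSupport' := by
    have hD : IsClosed {z : S × S | s z.1 = r z.2} :=
      isClosed_eq (continuous_s.comp continuous_fst) (continuous_r.comp continuous_snd)
    have hK : IsCompact ((fun z : S × S => mul z.1 z.2) ''
        ((tsupport f ×ˢ tsupport g) ∩ {z | s z.1 = r z.2})) :=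
      ((f.hasCompactSupport.isCompact.prod g.hasCompactSupport.isCompact).inter_right
        hD).image_of_continuousOn (continuousOn_mul.mono Set.inter_subset_right)
    refine HasCompactSupport.intro hK fun σ hσ => integral_eq_zero_of_ae ?_
    filter_upwards [T.ae_base lam (T.base σ)] with τ hτ
    by_contra hne
    obtain ⟨h1, h2⟩ := mul_ne_zero_iff.1 hne
    refine hσ ⟨(τ, mul (inv τ) σ), ⟨⟨subset_tsupport _ h1, subset_tsupport _ h2⟩, ?_⟩,
      mul_inv_cancel' (T.base_eq_iff.1 hτ)⟩
    change s τ = r (mul (inv τ) σ)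
    rw [r_mul _ _ (T.composable_inv hτ), r_inv]

theorem conv_act {χ : Γ →ₜ* Circle} (f : S → ℂ) {g : C_c(S, ℂ)} (hg : g ∈ T.equivariantCc χ)
    (α : Γ) (σ : S) : T.conv lam f g (T.act α σ) = χ α * T.conv lam f g σ := by
  rw [conv, conv, base_act, ← integral_const_mul]
  refine integral_congr_ae ?_
  filter_upwards [T.ae_base lam (T.base σ)] with τ hτ
  rw [T.mul_act α (T.composable_inv hτ), hg α]
  ring

/-- Convolution as an integral over `G`. -/
theorem conv_eq_integral_avg (f g : C_c(S, ℂ)) (σ : S) : T.conv lam f g σ =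
    ∫ γ, T.avg (fun τ => f τ * g (mul (inv τ) σ)) γ ∂(lam.meas (T.base σ)) := by
  refine T.integral_haar_fiber lam ?_ f.hasCompactSupport.isCompact ?_
  · refine f.continuous.continuousOn.mul (g.continuous.comp_continuousOn (continuousOn_gmul
        continuous_inv.continuousOn continuousOn_const ?_))
    exact fun τ hτ => T.composable_inv hτ
  · intro τ _ hτ
    rw [image_eq_zero_of_notMem_tsupport hτ, zero_mul]

/-- Convolution by a `χ`-equivariant function only sees the `χ`-isotypic part. -/
theorem conv_proj (χ : Γ →ₜ* Circle) (f : T.equivariantCc χ) (g : C_c(S, ℂ)) (σ : S) :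
    T.conv lam f.1 (T.proj χ g).1 σ = T.conv lam f.1 g σ := by
  rw [conv_eq_integral_avg, conv_eq_integral_avg]
  refine integral_congr_ae ?_
  filter_upwards [lam.ae_rng _] with γ hγ
  obtain ⟨τ, rfl⟩ := T.isQuotientMap_π.surjective γ
  have hτ : T.base τ = T.base σ := by rw [base_eq_rng, hγ]
  rw [T.avg_π_of_invariant fun α => T.conv_integrand_act f.2 (T.proj χ g).2 hτ α, avg_π,
    proj_apply, ← integral_const_mul]
  congr 1 with α
  rw [f.2 α τ, inv_act, T.act_mul _ (T.composable_inv hτ)]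
  ring

instance regular_haarInv (u : units G) : (T.haarInv lam u).Regular :=
  Measure.Regular.map (invHomeo S)

/-- Averages of a product of an equivariant function with a conjugate only depend on the isotypic
part of the other factor. -/
theorem integral_conj_mul_proj (χ : Γ →ₜ* Circle) (u : units G) (g : C_c(S, ℂ))
    (f : T.equivariantCc χ) : ∫ σ, starRingEnd ℂ ((T.proj χ g).1 σ) * f.1 σ ∂(T.haarInv lam u) =
      ∫ σ, starRingEnd ℂ (g σ) * f.1 σ ∂(T.haarInv lam u) := by
  have key : ∀ h : C_c(S, ℂ), ∫ σ, starRingEnd ℂ (h σ) * f.1 σ ∂(T.haarInv lam u) =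
      ∫ γ, T.avg (fun τ => starRingEnd ℂ (h (inv τ)) * f.1 (inv τ)) γ ∂(lam.meas u) := by
    intro h
    rw [integral_haarInv]
    refine T.integral_haar_fiber lam (Continuous.continuousOn ?_)
      (invCc f.1).hasCompactSupport.isCompact ?_
    · exact (Complex.continuous_conj.comp (h.continuous.comp continuous_inv)).mul
        (f.1.continuous.comp continuous_inv)
    · intro τ _ hτ
      have : f.1 (inv τ) = 0 := image_eq_zero_of_notMem_tsupport (f := invCc f.1) hτ
      rw [this, mul_zero]
  rw [key, key]
  congr 1 with γ
  obtain ⟨τ, rfl⟩ := T.isQuotientMap_π.surjective γ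
  have h1 : ∀ α, starRingEnd ℂ (χ α : ℂ) * (χ α : ℂ) = 1 := fun α => by
    rw [← Circle.coe_inv_eq_conj, Circle.coe_inv, inv_mul_cancel₀ (Circle.coe_ne_zero _)]
  have h2 : ∀ α, (χ α⁻¹ : ℂ) = starRingEnd ℂ (χ α : ℂ) := fun α => by
    rw [map_inv, Circle.coe_inv_eq_conj]
  rw [avg_π_of_invariant, avg_π, proj_apply, ← integral_conj, ← integral_mul_const]
  · congr 1 with α
    rw [inv_act, f.2 α⁻¹, h2, map_mul]
    ring
  · intro α
    rw [inv_act, f.2 α⁻¹, (T.proj χ g).2 α⁻¹, map_mul, h2, Complex.conj_conj]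
    linear_combination (starRingEnd ℂ ((T.proj χ g).1 (inv τ)) * f.1 (inv τ)) * h1 α

/-- `sup_u ∫ |f| dμ^u` is finite: the integral is continuous in `u` and vanishes off the image of
the support of `f`. -/
theorem exists_integral_norm_le (f : C_c(S, ℂ)) :
    ∃ C : ℝ, ∀ u, ∫ σ, ‖f σ‖ ∂(T.haar lam u) ≤ C := by
  have hc : Continuous fun u => ∫ σ, ‖f σ‖ ∂(T.haar lam u) := by
    have := T.continuous_integral_haar lam (absCc f)
    simp_rw [absCc_apply, integral_complex_ofReal] at this
    exact Complex.continuous_re.comp this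
  obtain ⟨C, hC⟩ := (f.hasCompactSupport.isCompact.image T.continuous_base).bddAbove_image
    hc.continuousOn
  refine ⟨max C 0, fun u => ?_⟩
  by_cases hu : u ∈ T.base '' tsupport f
  · exact (hC ⟨u, hu, rfl⟩).trans (le_max_left _ _)
  · have : ∫ σ, ‖f σ‖ ∂(T.haar lam u) = 0 := by
      refine integral_eq_zero_of_ae ?_
      filter_upwards [T.ae_base lam u] with σ hσ
      have : f σ = 0 := image_eq_zero_of_notMem_tsupport fun h => hu ⟨σ, h, hσ⟩
      simp [this]
    rw [this]
    exact le_max_right _ _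

/-- Convolution by `f` is bounded on `L²(S_u, μ_u)` by the `I`-norm of `f`. -/
theorem integral_norm_conv_sq_le (f g : C_c(S, ℂ)) {C : ℝ}
    (h1 : ∀ u, ∫ σ, ‖f σ‖ ∂(T.haar lam u) ≤ C)
    (h2 : ∀ u, ∫ σ, ‖f (inv σ)‖ ∂(T.haar lam u) ≤ C) (u : units G) :
    ∫ σ, ‖T.conv lam f g σ‖ ^ 2 ∂(T.haarInv lam u) ≤
      C ^ 2 * ∫ σ, ‖g σ‖ ^ 2 ∂(T.haarInv lam u) := by
  rw [integral_haarInv, integral_haarInv]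
  have hcomp : ∀ {ζ ξ : S}, T.base ζ = u → T.base ξ = u → s (inv ζ) = r ξ := fun hζ hξ =>
    T.composable_inv (hζ.trans hξ.symm)
  have hconv : ∀ ζ, T.base ζ = u → T.conv lam f g (inv ζ) =
      ∫ ξ, f (mul (inv ζ) ξ) * g (inv ξ) ∂(T.haar lam u) := by
    intro ζ hζ
    have := T.integral_haar_mul_left lam (inv ζ)
      (φ := fun τ => f τ * g (mul (inv τ) (inv ζ)))
      (f.continuous.continuousOn.mul (g.continuous.comp_continuousOn (continuousOn_gmul
        continuous_inv.continuousOn continuousOn_const fun τ hτ => T.composable_inv hτ)))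
      f.hasCompactSupport.isCompact (fun τ _ hτ => by
        rw [image_eq_zero_of_notMem_tsupport hτ, zero_mul])
    rw [inv_inv', hζ] at this
    rw [conv, ← this]
    refine integral_congr_ae ?_
    filter_upwards [T.ae_base lam u] with ξ hξ
    have hc := hcomp hζ hξ
    rw [inv_mul' hc, inv_inv', mul_mul_inv]
    rw [s_inv]
    exact T.base_eq_iff.1 (hξ.trans hζ.symm)
  have hfζ : ∀ ζ, T.base ζ = u → ContinuousOn (fun ξ => f (mul (inv ζ) ξ)) {ξ | T.base ξ = u} :=
    fun ζ hζ => f.continuous.comp_continuousOn (continuousOn_gmul continuousOn_const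
      continuousOn_id fun ξ hξ => hcomp hζ hξ)
  have hmul : ∀ {K L : Set S}, IsCompact K → IsCompact L →
      IsCompact ((fun z : S × S => mul z.1 z.2) '' ((K ×ˢ L) ∩ {z | s z.1 = r z.2})) :=
    fun hK hL => ((hK.prod hL).inter_right (isClosed_eq (continuous_s.comp continuous_fst)
      (continuous_r.comp continuous_snd))).image_of_continuousOn
        (continuousOn_mul.mono Set.inter_subset_right)
  calc ∫ ζ, ‖T.conv lam f g (inv ζ)‖ ^ 2 ∂(T.haar lam u)
      = ∫ ζ, ‖∫ ξ, f (mul (inv ζ) ξ) * g (inv ξ) ∂(T.haar lam u)‖ ^ 2 ∂(T.haar lam u) := by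
        refine integral_congr_ae ?_
        filter_upwards [T.ae_base lam u] with ζ hζ
        rw [hconv ζ hζ]
    _ ≤ C ^ 2 * ∫ ξ, ‖g (inv ξ)‖ ^ 2 ∂(T.haar lam u) := by
        refine schur_test (T.isClosed_fiber u) (T.haar_compl_fiber lam u)
          (k := fun ζ ξ => f (mul (inv ζ) ξ)) (h := fun ξ => g (inv ξ))
          (L := tsupport (invCc g))
          (K := _ '' ((tsupport (invCc g) ×ˢ tsupport (invCc f)) ∩ {z | s z.1 = r z.2}))
          ?_ (invCc g).continuous.continuousOn
          (hmul (invCc g).hasCompactSupport.isCompact (invCc f).hasCompactSupport.isCompact)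
          (invCc g).hasCompactSupport.isCompact
          (fun ξ _ hξ => image_eq_zero_of_notMem_tsupport (f := invCc g) hξ) ?_ ?_ ?_ ?_
        · refine f.continuous.comp_continuousOn (continuousOn_gmul
            (TopologicalGroupoid.continuous_inv.comp continuous_fst).continuousOn
            continuous_snd.continuousOn ?_)
          exact fun z hz => hcomp hz.1 hz.2
        · intro ζ hζ ξ hξ hξL hn
          by_contra hne
          have hc := hcomp hζ hξ
          have hc' : s ξ = r (mul (inv ξ) ζ) := by
            rw [r_mul _ _ (hcomp hξ hζ), r_inv]
          refine hn ⟨(ξ, mul (inv ξ) ζ), ⟨⟨hξL, subset_tsupport _ ?_⟩, hc'⟩,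
            mul_inv_cancel' (T.base_eq_iff.1 (Eq.trans hξ (Eq.symm hζ)))⟩
          change f (inv (mul (inv ξ) ζ)) ≠ 0
          rwa [inv_mul' (hcomp hξ hζ), inv_inv']
        · intro ζ hζ
          refine integrable_of_continuousOn_fiber (T.isClosed_fiber u) (T.haar_compl_fiber lam u)
            (hfζ ζ hζ) (hmul (isCompact_singleton (x := ζ)) f.hasCompactSupport.isCompact) ?_
          intro ξ hξ hn
          by_contra hne
          have hc := hcomp hζ hξ
          refine hn ⟨(ζ, mul (inv ζ) ξ), ⟨⟨rfl, subset_tsupport _ hne⟩, ?_⟩,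
            mul_inv_cancel' (T.base_eq_iff.1 (Eq.trans hζ (Eq.symm hξ)))⟩
          change s ζ = r (mul (inv ζ) ξ)
          rw [r_mul _ _ hc, r_inv]
        · intro ζ hζ
          have := T.integral_norm_haar_mul_left lam (inv ζ) (φ := f) f.continuous.continuousOn
            f.hasCompactSupport.isCompact fun τ _ hτ => image_eq_zero_of_notMem_tsupport hτ
          rw [inv_inv', show T.base ζ = u from hζ] at this
          rw [this]
          exact h1 _
        · intro ξ hξ
          have := T.integral_norm_haar_mul_left lam (inv ξ) (φ := invCc f)
            (invCc f).continuous.continuousOn (invCc f).hasCompactSupport.isCompact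
            fun τ _ hτ => image_eq_zero_of_notMem_tsupport hτ
          rw [inv_inv', show T.base ξ = u from hξ] at this
          refine le_trans (le_of_eq ?_) (h2 (T.base (inv ξ)))
          refine Eq.trans (integral_congr_ae ?_) this
          filter_upwards [T.ae_base lam u] with ζ hζ
          change _ = ‖f (inv (mul (inv ξ) ζ))‖
          rw [inv_mul' (hcomp hξ hζ), inv_inv']

end Twist

/-! ### The push-out of a twist along a character -/

namespace Twist

variable {Γ : Type w} {G : Type u} {S : Type v} [CommGroup Γ] [TopologicalSpace Γ]
  [IsTopologicalGroup Γ] [TopologicalSpace G] [TopologicalGroupoid G]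
  [TopologicalSpace S] [TopologicalGroupoid S] (T : Twist Γ G S) (χ : Γ →ₜ* Circle)

/-- The action `α · (z, σ) = (z χ(α)⁻¹, α · σ)` of `Γ` on `𝕋 × S`. -/
noncomputable def pushAct (α : Γ) (p : Circle × S) : Circle × S := (p.1 * (χ α)⁻¹, T.act α p.2)

theorem continuous_pushAct : Continuous (Function.uncurry (T.pushAct χ)) :=
  ((continuous_fst.comp continuous_snd).mul ((map_continuous χ).comp continuous_fst).inv).prodMk
    (T.continuous_act.comp (continuous_fst.prodMk (continuous_snd.comp continuous_snd)))

/-- The orbit relation of `pushAct`. -/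
def pushSetoid : Setoid (Circle × S) where
  r p q := ∃ α, q = T.pushAct χ α p
  iseqv := by
    refine ⟨fun p => ⟨1, ?_⟩, ?_, ?_⟩
    · simp [pushAct, act_one]
    · rintro p q ⟨α, rfl⟩
      refine ⟨α⁻¹, ?_⟩
      simp [pushAct, act_act, act_one]
    · rintro p q t ⟨α, rfl⟩ ⟨β, rfl⟩
      refine ⟨β * α, ?_⟩
      simp [pushAct, act_act, mul_assoc, mul_comm]

/-- The quotient of `𝕋 × S` by the action `α · (z, σ) = (z χ(α)⁻¹, α · σ)` of `Γ`: the total space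
of the push-out of the twist along `χ`. -/
def Push : Type v := Quotient (T.pushSetoid χ)

namespace Push

instance : TopologicalSpace (T.Push χ) :=
  inferInstanceAs (TopologicalSpace (Quotient (T.pushSetoid χ)))

/-- The class of `(z, σ)`. -/
noncomputable def mk (z : Circle) (σ : S) : T.Push χ := Quotient.mk (T.pushSetoid χ) (z, σ)

theorem mk_eq_iff {z w : Circle} {σ τ : S} :
    mk T χ z σ = mk T χ w τ ↔ ∃ α, w = z * (χ α)⁻¹ ∧ τ = T.act α σ := by
  refine Quotient.eq.trans (exists_congr fun α => ?_)
  simp [pushAct]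

theorem mk_act (z : Circle) (α : Γ) (σ : S) :
    mk T χ z (T.act α σ) = mk T χ (z * χ α) σ :=
  ((mk_eq_iff T χ).2 ⟨α, by simp, rfl⟩).symm

theorem exists_mk (x : T.Push χ) : ∃ z σ, x = mk T χ z σ := by
  obtain ⟨⟨z, σ⟩, rfl⟩ := Quotient.exists_rep x
  exact ⟨z, σ, rfl⟩

theorem isQuotientMap_mk : IsQuotientMap fun p : Circle × S => mk T χ p.1 p.2 :=
  isQuotientMap_quot_mk

theorem mk_eq_iff_pushAct (p q : Circle × S) :
    mk T χ p.1 p.2 = mk T χ q.1 q.2 ↔ ∃ α, q = T.pushAct χ α p := by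
  rw [mk_eq_iff]
  simp [pushAct, Prod.ext_iff]

theorem isOpenQuotientMap_mk : IsOpenQuotientMap fun p : Circle × S => mk T χ p.1 p.2 :=
  ⟨(isQuotientMap_mk T χ).surjective, (isQuotientMap_mk T χ).continuous,
    isOpenMap_of_orbits (T.continuous_pushAct χ) (isQuotientMap_mk T χ) (mk_eq_iff_pushAct T χ)⟩

theorem continuous_mk {X : Type*} [TopologicalSpace X] {f : X → Circle} {g : X → S}
    (hf : Continuous f) (hg : Continuous g) : Continuous fun x => mk T χ (f x) (g x) :=
  (isQuotientMap_mk T χ).continuous.comp (hf.prodMk hg)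

instance [LocallyCompactSpace S] : LocallyCompactSpace (T.Push χ) :=
  (isOpenQuotientMap_mk T χ).locallyCompactSpace

instance [CompactSpace Γ] [T2Space S] : T2Space (T.Push χ) :=
  t2Space_of_orbits (T.continuous_pushAct χ) (isQuotientMap_mk T χ) (mk_eq_iff_pushAct T χ)

/-- The range map of the push-out. -/
noncomputable def rMap (x : T.Push χ) : T.Push χ :=
  Quotient.lift (fun p : Circle × S => mk T χ 1 (r p.2)) (by
    rintro p q ⟨α, rfl⟩
    simp [pushAct, r_act]) x

/-- The source map of the push-out. -/
noncomputable def sMap (x : T.Push χ) : T.Push χ :=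
  Quotient.lift (fun p : Circle × S => mk T χ 1 (s p.2)) (by
    rintro p q ⟨α, rfl⟩
    simp [pushAct, s_act]) x

/-- The inversion of the push-out. -/
noncomputable def invMap (x : T.Push χ) : T.Push χ :=
  Quotient.lift (fun p : Circle × S => mk T χ p.1⁻¹ (inv p.2)) (by
    rintro p q ⟨α, rfl⟩
    simp [pushAct, inv_act, mk_act]) x

/-- The product of the push-out, computed on representatives.  It is independent of the
representatives for composable pairs only, so they have to be chosen. -/
noncomputable def mulMap (x y : T.Push χ) : T.Push χ :=
  mk T χ (x.out.1 * y.out.1) (mul x.out.2 y.out.2)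

/-- For composable arguments, all representatives give the same product. -/
theorem mulMap_mk (z w : Circle) {σ τ : S} (h : s σ = r τ) :
    mulMap T χ (mk T χ z σ) (mk T χ w τ) = mk T χ (z * w) (mul σ τ) := by
  have hx : mk T χ (mk T χ z σ).out.1 (mk T χ z σ).out.2 = mk T χ z σ :=
    Quotient.out_eq (mk T χ z σ)
  have hy : mk T χ (mk T χ w τ).out.1 (mk T χ w τ).out.2 = mk T χ w τ :=
    Quotient.out_eq (mk T χ w τ)
  obtain ⟨α, h1, h2⟩ := (mk_eq_iff T χ).1 hx.symm
  obtain ⟨β, h3, h4⟩ := (mk_eq_iff T χ).1 hy.symm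
  rw [mulMap, h1, h2, h3, h4, T.act_mul _ (by rw [r_act, h]), T.mul_act _ h, mk_act, mk_act]
  congr 1
  rw [mul_mul_mul_comm, ← mul_inv_rev, mul_assoc _ (χ α), mul_comm (χ α), inv_mul_cancel_right]

theorem mk_one_unit_inj {σ τ : S} (hσ : r σ = σ) (hτ : r τ = τ)
    (h : mk T χ 1 σ = mk T χ 1 τ) : σ = τ := by
  obtain ⟨α, -, h2⟩ := (mk_eq_iff T χ).1 h
  rw [← hσ, ← hτ, h2, r_act]

theorem composable_of_mk {z w : Circle} {σ τ : S}
    (h : sMap T χ (mk T χ z σ) = rMap T χ (mk T χ w τ)) : s σ = r τ :=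
  mk_one_unit_inj T χ (r_s σ) (r_r τ) h

theorem continuousOn_mulMap : ContinuousOn (fun p : T.Push χ × T.Push χ => mulMap T χ p.1 p.2)
    {p | sMap T χ p.1 = rMap T χ p.2} := by
  have hq := (isOpenQuotientMap_mk T χ).prodMap (isOpenQuotientMap_mk T χ)
  intro x hx
  obtain ⟨p, rfl⟩ := hq.surjective x
  rw [ContinuousWithinAt, nhdsWithin, ← hq.map_nhds_eq, ← Filter.map_inf_principal_preimage,
    Filter.tendsto_map'_iff]
  have hc : ContinuousOn (fun p : (Circle × S) × (Circle × S) =>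
      mk T χ (p.1.1 * p.2.1) (mul p.1.2 p.2.2)) {p | s p.1.2 = r p.2.2} :=
    (isQuotientMap_mk T χ).continuous.comp_continuousOn
      (ContinuousOn.prodMk (by fun_prop) (continuousOn_gmul (by fun_prop) (by fun_prop)
        fun p hp => hp))
  have hp : s p.1.2 = r p.2.2 := composable_of_mk T χ hx
  have h1 := hc p hp
  rw [ContinuousWithinAt, ← mulMap_mk T χ _ _ hp] at h1
  refine Filter.Tendsto.congr' ?_ (h1.mono_left (inf_le_inf_left _ (Filter.principal_mono.2 ?_)))
  · filter_upwards [Filter.mem_inf_of_right (Filter.mem_principal_self _)] with q hq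
    exact (mulMap_mk T χ _ _ (composable_of_mk T χ hq)).symm
  · exact fun q hq => composable_of_mk T χ hq

/-- The push-out as a groupoid, with `[z, σ][w, τ] = [zw, στ]`. -/
noncomputable instance : TopologicalGroupoid (T.Push χ) where
  r := rMap T χ
  s := sMap T χ
  mul := mulMap T χ
  inv := invMap T χ
  r_mul x y h := by
    obtain ⟨z, σ, rfl⟩ := exists_mk T χ x
    obtain ⟨w, τ, rfl⟩ := exists_mk T χ y
    have hc := composable_of_mk T χ h
    rw [mulMap_mk T χ z w hc]
    exact congrArg (mk T χ 1) (r_mul σ τ hc)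
  s_mul x y h := by
    obtain ⟨z, σ, rfl⟩ := exists_mk T χ x
    obtain ⟨w, τ, rfl⟩ := exists_mk T χ y
    have hc := composable_of_mk T χ h
    rw [mulMap_mk T χ z w hc]
    exact congrArg (mk T χ 1) (s_mul σ τ hc)
  assoc x y t h h' := by
    obtain ⟨z, σ, rfl⟩ := exists_mk T χ x
    obtain ⟨w, τ, rfl⟩ := exists_mk T χ y
    obtain ⟨v, ρ, rfl⟩ := exists_mk T χ t
    have hc := composable_of_mk T χ h
    have hc' := composable_of_mk T χ h'
    rw [mulMap_mk T χ z w hc, mulMap_mk T χ w v hc',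
      mulMap_mk T χ _ _ (by rw [s_mul _ _ hc, hc']), mulMap_mk T χ _ _ (by rw [r_mul _ _ hc', hc]),
      assoc _ _ _ hc hc', mul_assoc]
  r_inv x := by
    obtain ⟨z, σ, rfl⟩ := exists_mk T χ x
    exact congrArg (mk T χ 1) (r_inv σ)
  s_inv x := by
    obtain ⟨z, σ, rfl⟩ := exists_mk T χ x
    exact congrArg (mk T χ 1) (s_inv σ)
  mul_inv_self x := by
    obtain ⟨z, σ, rfl⟩ := exists_mk T χ x
    change mulMap T χ _ (mk T χ z⁻¹ (inv σ)) = mk T χ 1 (r σ)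
    rw [mulMap_mk T χ _ _ (r_inv σ).symm, mul_inv_self, mul_inv_cancel]
  inv_mul_self x := by
    obtain ⟨z, σ, rfl⟩ := exists_mk T χ x
    change mulMap T χ (mk T χ z⁻¹ (inv σ)) _ = mk T χ 1 (s σ)
    rw [mulMap_mk T χ _ _ (s_inv σ), inv_mul_self, inv_mul_cancel]
  r_mul_self x := by
    obtain ⟨z, σ, rfl⟩ := exists_mk T χ x
    change mulMap T χ (mk T χ 1 (r σ)) _ = _
    rw [mulMap_mk T χ _ _ (s_r σ), r_mul_self, one_mul]
  mul_s_self x := by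
    obtain ⟨z, σ, rfl⟩ := exists_mk T χ x
    change mulMap T χ _ (mk T χ 1 (s σ)) = _
    rw [mulMap_mk T χ _ _ (r_s σ).symm, mul_s_self, mul_one]
  continuousOn_mul := continuousOn_mulMap T χ
  continuous_inv := by
    rw [(isQuotientMap_mk T χ).continuous_iff]
    exact continuous_mk T χ continuous_fst.inv (continuous_inv.comp continuous_snd)

theorem r_mk (z : Circle) (σ : S) : r (mk T χ z σ) = mk T χ 1 (r σ) := rfl

theorem s_mk (z : Circle) (σ : S) : s (mk T χ z σ) = mk T χ 1 (s σ) := rfl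

theorem inv_mk (z : Circle) (σ : S) : inv (mk T χ z σ) = mk T χ z⁻¹ (inv σ) := rfl

theorem mul_mk (z w : Circle) {σ τ : S} (h : s σ = r τ) :
    mul (mk T χ z σ) (mk T χ w τ) = mk T χ (z * w) (mul σ τ) := mulMap_mk T χ z w h

theorem composable_mk {z w : Circle} {σ τ : S} :
    s (mk T χ z σ) = r (mk T χ w τ) ↔ s σ = r τ :=
  ⟨composable_of_mk T χ, fun h => congrArg (mk T χ 1) h⟩

/-- The embedding of the trivial circle bundle into the push-out. -/
noncomputable def inc (p : units G × Circle) : T.Push χ := mk T χ p.2 (T.ι (p.1, 1))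

/-- The projection of the push-out onto `G`. -/
noncomputable def pr (x : T.Push χ) : G :=
  Quotient.lift (fun p : Circle × S => T.π p.2) (by
    rintro p q ⟨α, rfl⟩
    exact (T.π_act α p.2).symm) x

theorem pr_inc (u : units G) (z : Circle) : pr T χ (inc T χ (u, z)) = u := T.π_ι u 1

theorem act_ι_one (u : units G) (α : Γ) : T.act α (T.ι (u, 1)) = T.ι (u, α) := by
  rw [act, base_ι, ι_mul, mul_one]

theorem inc_base (z : Circle) (σ : S) : inc T χ (T.base σ, z) = mk T χ z (r σ) := by
  rw [inc, ι_base_one]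

theorem hom_inc : IsGroupoidHom (inc T χ) := by
  rintro ⟨u, z⟩ ⟨v, w⟩ h
  obtain rfl : u = v := congrArg Prod.fst h
  have hc : s (T.ι (u, 1)) = r (T.ι (u, 1)) := by rw [s_ι, r_ι]
  refine ⟨(composable_mk T χ).2 hc, ?_⟩
  change mk T χ (z * w) (T.ι (u, 1)) = mul (mk T χ z _) (mk T χ w _)
  rw [mul_mk T χ z w hc, ι_mul, mul_one]

theorem hom_pr : IsGroupoidHom (pr T χ) := by
  intro x y h
  obtain ⟨z, σ, rfl⟩ := exists_mk T χ x
  obtain ⟨w, τ, rfl⟩ := exists_mk T χ y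
  have hc := (composable_mk T χ).1 h
  rw [mul_mk T χ z w hc]
  exact T.hom_π σ τ hc

theorem continuous_inc : Continuous (inc T χ) :=
  continuous_mk T χ continuous_snd
    (T.isEmbedding_ι.continuous.comp (continuous_fst.prodMk continuous_const))

theorem continuous_pr : Continuous (pr T χ) := by
  rw [(isQuotientMap_mk T χ).continuous_iff]
  exact T.continuous_π.comp continuous_snd

theorem inc_injective : Function.Injective (inc T χ) := by
  rintro ⟨u, z⟩ ⟨v, w⟩ h
  obtain ⟨α, h1, h2⟩ := (mk_eq_iff T χ).1 h
  rw [act_ι_one] at h2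
  have h3 := T.isEmbedding_ι.injective h2
  obtain rfl : v = u := congrArg Prod.fst h3
  obtain rfl : 1 = α := congrArg Prod.snd h3
  simpa using h1.symm

theorem units_eq_inc : units (T.Push χ) = inc T χ '' {p | p.2 = 1} := by
  ext x
  constructor
  · intro hx
    obtain ⟨z, σ, rfl⟩ := exists_mk T χ x
    refine ⟨(T.base σ, 1), rfl, ?_⟩
    rw [inc_base]
    exact hx
  · rintro ⟨⟨u, z⟩, rfl, rfl⟩
    change r (mk T χ 1 (T.ι (u, 1))) = mk T χ 1 (T.ι (u, 1))
    rw [r_mk, r_ι]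

/-- `inc` is a closed map, because the orbits of the compact group `Γ` in `𝕋 × S` are the fibres of
a proper map. -/
theorem isEmbedding_inc [CompactSpace Γ] [T2Space S] : IsEmbedding (inc T χ) := by
  have h1 : IsClosedEmbedding fun u : units G => T.ι (u, 1) := by
    refine ⟨T.isEmbedding_ι.comp (isEmbedding_prodMkLeft 1), ?_⟩
    have : Set.range (fun u : units G => T.ι (u, 1)) = units S := by
      rw [T.units_eq]
      ext x
      simp
    rw [this]
    exact isClosed_eq continuous_r continuous_id
  have h2 : IsClosedMap (inc T χ) := by
    have h3 : IsClosedMap fun p : Circle × S => mk T χ p.1 p.2 :=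
      (isProperMap_of_orbits (T.continuous_pushAct χ) (isQuotientMap_mk T χ)
        (mk_eq_iff_pushAct T χ)).isClosedMap
    exact h3.comp ((IsClosedEmbedding.id.prodMap h1).isClosedMap.comp
      (Homeomorph.prodComm _ _).isClosedMap)
  exact (IsClosedEmbedding.of_continuous_injective_isClosedMap (continuous_inc T χ)
    (inc_injective T χ) h2).isEmbedding

/-- The push-out of a `Γ`-twist along a character of `Γ`, a `𝕋`-twist over the same groupoid. -/
noncomputable def twist [CompactSpace Γ] [T2Space S] : Twist Circle G (T.Push χ) where
  ι := inc T χ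
  π := pr T χ
  units_eq := units_eq_inc T χ
  hom_ι := hom_inc T χ
  hom_π := hom_pr T χ
  isEmbedding_ι := isEmbedding_inc T χ
  isQuotientMap_π := by
    refine IsQuotientMap.of_comp (isQuotientMap_mk T χ).continuous (continuous_pr T χ) ?_
    exact T.isQuotientMap_π.comp isOpenQuotientMap_snd.isQuotientMap
  isHomeomorph_ι := by
    rw [isHomeomorph_iff_exists_inverse]
    refine ⟨(continuous_inc T χ).restrict _,
      fun x => ⟨(⟨pr T χ x, (hom_pr T χ).mapsTo x.2⟩, 1), rfl⟩, ?_, ?_, ?_⟩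
    · rintro ⟨⟨u, z⟩, h⟩
      obtain rfl : 1 = z := congrArg Prod.snd h
      exact Subtype.ext (Prod.ext (Subtype.ext (pr_inc T χ u 1)) rfl)
    · rintro ⟨x, hx⟩
      rw [units_eq_inc] at hx
      obtain ⟨⟨u, z⟩, rfl, rfl⟩ := hx
      refine Subtype.ext ?_
      change inc T χ (_, 1) = inc T χ (u, 1)
      congr 2
      exact Subtype.ext (pr_inc T χ u 1)
    · exact ((((continuous_pr T χ).comp continuous_subtype_val).subtype_mk _).prodMk
        continuous_const).subtype_mk _
  isHomeomorph_π := by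
    rw [isHomeomorph_iff_exists_inverse]
    have hmem : ∀ u : units G, inc T χ (u, 1) ∈ units (T.Push χ) := fun u => by
      rw [units_eq_inc]; exact ⟨_, rfl, rfl⟩
    refine ⟨(continuous_pr T χ).restrict _, fun u => ⟨inc T χ (u, 1), hmem u⟩, ?_, ?_, ?_⟩
    · rintro ⟨x, hx⟩
      obtain ⟨⟨u, z⟩, rfl, rfl⟩ := (units_eq_inc T χ).subset hx
      refine Subtype.ext ?_
      change inc T χ (_, 1) = inc T χ (u, 1)
      congr 2
      exact Subtype.ext (pr_inc T χ u 1)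
    · intro u
      exact Subtype.ext (pr_inc T χ u 1)
    · exact ((continuous_inc T χ).comp (continuous_id.prodMk continuous_const)).subtype_mk _
  exact := by
    ext x
    constructor
    · rintro ⟨⟨u, z⟩, rfl⟩
      change pr T χ _ ∈ units G
      rw [pr_inc]
      exact u.2
    · intro hx
      obtain ⟨z, σ, rfl⟩ := exists_mk T χ x
      have hσ : σ ∈ Set.range T.ι := by rw [T.exact]; exact hx
      obtain ⟨⟨u, α⟩, rfl⟩ := hσ
      refine ⟨(u, z * χ α), ?_⟩
      change mk T χ (z * χ α) (T.ι (u, 1)) = _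
      rw [← mk_act, act_ι_one]
  central x α := by
    obtain ⟨z, σ, rfl⟩ := exists_mk T χ x
    have h1 : inc T χ (⟨pr T χ (r (mk T χ z σ)), (hom_pr T χ).mapsTo (r_r _)⟩, α) =
        mk T χ α (r σ) := inc_base T χ α σ
    have h2 : inc T χ (⟨pr T χ (s (mk T χ z σ)), (hom_pr T χ).mapsTo (r_s _)⟩, α) =
        mk T χ α (s σ) := by
      have := inc_base T χ α (s σ)
      rw [r_s] at this
      rw [← this]
      congr 2
      exact Subtype.ext (by change T.π (s σ) = T.π (r (s σ)); rw [r_s])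
    refine ⟨?_, ?_, ?_⟩
    · rw [h1, s_mk, s_r, r_mk]
    · rw [h2, r_mk, r_s, s_mk]
    · rw [h1, h2, mul_mk T χ _ _ (s_r σ), mul_mk T χ _ _ (r_s σ).symm, r_mul_self, mul_s_self,
        mul_comm]

end Push

end Twist

/-! ### Linear maps between generated C⋆-algebras -/

section CStarClosure

variable {A B : Type*} [NonUnitalCStarAlgebra A] [NonUnitalCStarAlgebra B]

theorem subset_cstarClosure (s : Set A) : s ⊆ cstarClosure s := fun _ hx =>
  NonUnitalStarSubalgebra.le_topologicalClosure _ (NonUnitalStarAlgebra.subset_adjoin ℂ s hx)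

theorem isClosed_cstarClosure (s : Set A) : IsClosed (cstarClosure s : Set A) :=
  NonUnitalStarSubalgebra.isClosed_topologicalClosure _

theorem cstarClosure_induction {s : Set A} {p : A → Prop} (hp : IsClosed {x | p x})
    (mem : ∀ x ∈ s, p x) (zero : p 0) (add : ∀ x y, p x → p y → p (x + y))
    (smul : ∀ (c : ℂ) x, p x → p (c • x))
    (mul : ∀ x y, x ∈ cstarClosure s → y ∈ cstarClosure s → p x → p y → p (x * y))
    (star : ∀ x ∈ cstarClosure s, p x → p (star x)) {x : A} (hx : x ∈ cstarClosure s) : p x := by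
  have hle := NonUnitalStarSubalgebra.le_topologicalClosure (NonUnitalStarAlgebra.adjoin ℂ s)
  have h : (NonUnitalStarAlgebra.adjoin ℂ s : Set A) ⊆ {x | p x} := fun x hx =>
    NonUnitalStarAlgebra.adjoin_induction ℂ (p := fun x _ => p x) mem
      (fun x y _ _ => add x y) zero (fun x y hx hy => mul x y (hle hx) (hle hy))
      (fun c x _ => smul c x) (fun x hx => star x (hle hx)) hx
  exact closure_minimal h hp hx

/-- `F` is multiplicative at `x`, from both sides. -/
def MultiplicativeAt (F : A →L[ℂ] B) (x : A) : Prop :=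
  ∀ y, F (x * y) = F x * F y ∧ F (y * x) = F y * F x

variable {s : Set A} {t : Set B} {F : A →L[ℂ] B} {F' : B →L[ℂ] A}

/-- The set of points at which `F` is multiplicative is a closed `*`-subalgebra. -/
theorem multiplicativeAt_of_mem_cstarClosure (hF : ∀ x, F (star x) = star (F x))
    (hm : ∀ x ∈ s, MultiplicativeAt F x) {x : A} (hx : x ∈ cstarClosure s) :
    MultiplicativeAt F x := by
  refine cstarClosure_induction (p := MultiplicativeAt F) ?_ hm ?_ ?_ ?_ ?_ ?_ hx
  · have : {x | MultiplicativeAt F x} =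
        ⋂ y, {x | F (x * y) = F x * F y} ∩ {x | F (y * x) = F y * F x} := by
      ext x; simp [MultiplicativeAt]
    rw [this]
    exact isClosed_iInter fun y => (isClosed_eq (by fun_prop) (by fun_prop)).inter
      (isClosed_eq (by fun_prop) (by fun_prop))
  · intro y; simp
  · intro x x' h h' y
    simp [add_mul, mul_add, (h y).1, (h y).2, (h' y).1, (h' y).2]
  · intro c x h y
    simp [smul_mul_assoc, mul_smul_comm, (h y).1, (h y).2]
  · intro x x' _ _ h h' y
    constructor
    · rw [mul_assoc, (h _).1, (h' _).1, (h _).1, mul_assoc]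
    · rw [← mul_assoc, (h' _).2, (h _).2, (h' _).2, mul_assoc]
  · intro x _ h y
    constructor
    · have := congrArg star (h (star y)).2
      rwa [← hF, star_mul, star_star, star_mul, ← hF, ← hF, star_star] at this
    · have := congrArg star (h (star y)).1
      rwa [← hF, star_mul, star_star, star_mul, ← hF, ← hF, star_star] at this

theorem map_mem_cstarClosure (hF : ∀ x, F (star x) = star (F x))
    (hm : ∀ x ∈ s, MultiplicativeAt F x) (hst : ∀ x ∈ s, F x ∈ t) {x : A}
    (hx : x ∈ cstarClosure s) : F x ∈ cstarClosure t := by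
  refine cstarClosure_induction (p := fun x => F x ∈ cstarClosure t)
    ((isClosed_cstarClosure t).preimage F.continuous) (fun x hx => subset_cstarClosure t (hst x hx))
    ?_ ?_ ?_ ?_ ?_ hx
  · rw [map_zero]; exact zero_mem _
  · intro x y hx hy; rw [map_add]; exact add_mem hx hy
  · intro c x hx; rw [map_smul]; exact SMulMemClass.smul_mem c hx
  · intro x y hx _ hx' hy'
    rw [(multiplicativeAt_of_mem_cstarClosure hF hm hx y).1]
    exact mul_mem hx' hy'
  · intro x _ hx'; rw [hF]; exact star_mem hx'

theorem leftInverse_on_cstarClosure (hF : ∀ x, F (star x) = star (F x))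
    (hF' : ∀ x, F' (star x) = star (F' x)) (hst : ∀ x ∈ s, F x ∈ t) (hl : ∀ x ∈ s, F' (F x) = x)
    (hm : ∀ x ∈ s, MultiplicativeAt F x) (hm' : ∀ x ∈ t, MultiplicativeAt F' x) {x : A}
    (hx : x ∈ cstarClosure s) : F' (F x) = x := by
  refine cstarClosure_induction (p := fun x => F' (F x) = x)
    (isClosed_eq (by fun_prop) (by fun_prop)) hl (by simp) ?_ ?_ ?_ ?_ hx
  · intro x y hx hy; rw [map_add, map_add, hx, hy]
  · intro c x hx; rw [map_smul, map_smul, hx]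
  · intro x y hx _ hx' hy'
    rw [(multiplicativeAt_of_mem_cstarClosure hF hm hx y).1,
      (multiplicativeAt_of_mem_cstarClosure hF' hm' (map_mem_cstarClosure hF hm hst hx) _).1,
      hx', hy']
  · intro x _ hx'; rw [hF, hF', hx']

/-- Two continuous linear `*`-maps that restrict to mutually inverse bijections between sets `s` and
`t`, and that are multiplicative at the points of these sets, restrict to mutually inverse
isomorphisms between the C⋆-algebras generated by `s` and `t`. -/
theorem exists_cstarClosure_equiv (hF : ∀ x, F (star x) = star (F x))
    (hF' : ∀ x, F' (star x) = star (F' x)) (hst : ∀ x ∈ s, F x ∈ t) (hts : ∀ y ∈ t, F' y ∈ s)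
    (hl : ∀ x ∈ s, F' (F x) = x) (hr : ∀ y ∈ t, F (F' y) = y)
    (hm : ∀ x ∈ s, MultiplicativeAt F x) (hm' : ∀ x ∈ t, MultiplicativeAt F' x) :
    ∃ Φ : cstarClosure s ≃⋆ₐ[ℂ] cstarClosure t, ∀ x, (Φ x : B) = F x :=
  ⟨{ toFun := fun x => ⟨F x, map_mem_cstarClosure hF hm hst x.2⟩
     invFun := fun y => ⟨F' y, map_mem_cstarClosure hF' hm' hts y.2⟩
     left_inv := fun x => Subtype.ext (leftInverse_on_cstarClosure hF hF' hst hl hm hm' x.2)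
     right_inv := fun y => Subtype.ext (leftInverse_on_cstarClosure hF' hF hts hr hm' hm y.2)
     map_mul' := fun x y =>
       Subtype.ext (multiplicativeAt_of_mem_cstarClosure hF hm x.2 (y : A)).1
     map_add' := fun x y => Subtype.ext (map_add F (x : A) y)
     map_star' := fun x => Subtype.ext (hF x)
     map_smul' := fun c x => Subtype.ext (map_smul F c (x : A)) }, fun _ => rfl⟩

end CStarClosure

section Families

variable {I J : Type*} {E : I → Type*} [∀ i, NormedAddCommGroup (E i)]
  [∀ i, InnerProductSpace ℂ (E i)] [∀ i, CompleteSpace (E i)] {H : J → Type*}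
  [∀ j, NormedAddCommGroup (H j)] [∀ j, InnerProductSpace ℂ (H j)] [∀ j, CompleteSpace (H j)]

/-- The map `(x_i)_i ↦ (Θ_j(x_{φ(j)}))_j` between spaces of bounded families of operators, for
contractions `Θ_j`. -/
noncomputable def familyMap (φ : J → I)
    (Θ : ∀ j, (E (φ j) →L[ℂ] E (φ j)) →ₗ[ℂ] (H j →L[ℂ] H j)) (hΘ : ∀ j a, ‖Θ j a‖ ≤ ‖a‖) :
    BoundedFamily E →L[ℂ] BoundedFamily H :=
  LinearMap.mkContinuous
    { toFun := fun x => ⟨fun j => Θ j (x (φ j)), memℓp_infty ⟨‖x‖, by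
        rintro _ ⟨j, rfl⟩
        exact (hΘ j _).trans (lp.norm_apply_le_norm ENNReal.top_ne_zero x _)⟩⟩
      map_add' := fun x y => by
        ext1; funext j; exact map_add (Θ j) (x (φ j)) (y (φ j))
      map_smul' := fun c x => by
        ext1; funext j; exact map_smul (Θ j) c (x (φ j)) } 1 fun x => by
    rw [one_mul]
    exact lp.norm_le_of_forall_le (norm_nonneg _) fun j =>
      (hΘ j _).trans (lp.norm_apply_le_norm ENNReal.top_ne_zero x _)

theorem BoundedFamily.mul_apply (x y : BoundedFamily E) (i : I) : (x * y) i = x i * y i := rfl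

theorem BoundedFamily.star_apply (x : BoundedFamily E) (i : I) : (star x) i = star (x i) := rfl

theorem BoundedFamily.ext {x y : BoundedFamily E} (h : ∀ i, x i = y i) : x = y :=
  lp.ext (funext h)

end Families

/-! ### Square-integrable functions, representations, and the full C⋆-algebra -/

namespace Twist

section Involution

variable {Γ : Type w} {G : Type u} {S : Type v} [CommGroup Γ] [TopologicalSpace Γ]
  [IsTopologicalGroup Γ] [TopologicalSpace G] [TopologicalGroupoid G]
  [TopologicalSpace S] [TopologicalGroupoid S] (T : Twist Γ G S) (χ : Γ →ₜ* Circle)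

/-- The involution of `C_c(S; G; χ)`. -/
noncomputable def involution (f : T.equivariantCc χ) : T.equivariantCc χ :=
  ⟨star (invCc f.1), fun α σ => by
    change starRingEnd ℂ (f.1 (inv (T.act α σ))) = χ α * starRingEnd ℂ (f.1 (inv σ))
    rw [inv_act, f.2 α⁻¹, map_mul, map_inv, ← Circle.coe_inv_eq_conj, inv_inv]⟩

end Involution

section SquareIntegrable

variable {Γ : Type w} {G : Type u} {S : Type v} [CommGroup Γ] [TopologicalSpace Γ]
  [IsTopologicalGroup Γ] [CompactSpace Γ] [TopologicalSpace G] [TopologicalGroupoid G]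
  [TopologicalSpace S] [TopologicalGroupoid S] (T : Twist Γ G S) [T2Space S] [T2Space G]
  [LocallyCompactSpace S] (χ : Γ →ₜ* Circle) (lam : HaarSystem G) (u : units G)

theorem memLp_two (f : C_c(S, ℂ)) : MemLp f 2 (T.haarInv lam u) :=
  f.continuous.memLp_of_hasCompactSupport f.hasCompactSupport

/-- The class of a function in `C_c(S)` in `L²(S_u, μ_u)`. -/
noncomputable def toL2 : C_c(S, ℂ) →ₗ[ℂ] T.L2 lam u where
  toFun f := (T.memLp_two lam u f).toLp f
  map_add' _ _ := rfl
  map_smul' _ _ := rfl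

theorem coeFn_toL2 (f : C_c(S, ℂ)) : T.toL2 lam u f =ᵐ[T.haarInv lam u] f :=
  (T.memLp_two lam u f).coeFn_toLp

theorem eq_toL2 {ξ : T.L2 lam u} {f : C_c(S, ℂ)} (h : ξ =ᵐ[T.haarInv lam u] f) :
    ξ = T.toL2 lam u f :=
  Lp.ext (h.trans (T.coeFn_toL2 lam u f).symm)

theorem inner_toL2 (f g : C_c(S, ℂ)) : inner ℂ (T.toL2 lam u f) (T.toL2 lam u g) =
    ∫ σ, starRingEnd ℂ (f σ) * g σ ∂(T.haarInv lam u) := by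
  rw [L2.inner_def]
  refine integral_congr_ae ?_
  filter_upwards [T.coeFn_toL2 lam u f, T.coeFn_toL2 lam u g] with σ h1 h2
  rw [h1, h2, RCLike.inner_apply, mul_comm]

theorem norm_toL2_sq (f : C_c(S, ℂ)) :
    ‖T.toL2 lam u f‖ ^ 2 = ∫ σ, ‖f σ‖ ^ 2 ∂(T.haarInv lam u) := by
  have h2 : ∀ σ, starRingEnd ℂ (f σ) * f σ = ((‖f σ‖ ^ 2 : ℝ) : ℂ) := fun σ => by
    rw [Complex.conj_mul']; push_cast; rfl
  rw [← inner_self_eq_norm_sq (𝕜 := ℂ), inner_toL2]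
  simp_rw [h2]
  rw [integral_complex_ofReal]
  exact Complex.ofReal_re _

theorem denseRange_toL2 : DenseRange (T.toL2 lam u) := by
  intro ξ
  rw [EMetric.mem_closure_iff]
  intro ε hε
  obtain ⟨ε', h0, hlt⟩ := exists_between hε
  obtain ⟨g, hg⟩ := exists_cc_eLpNorm_sub_le (Lp.memLp ξ) h0.ne'
  refine ⟨T.toL2 lam u g, ⟨_, rfl⟩, ?_⟩
  rw [Lp.edist_def]
  refine lt_of_le_of_lt (le_of_eq (eLpNorm_congr_ae ?_)) (hg.trans_lt hlt)
  filter_upwards [T.coeFn_toL2 lam u g] with σ hσ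
  simp only [Pi.sub_apply, hσ]

/-- The isotypic projection is a contraction for the norm of `L²(S_u, μ_u)`, being self-adjoint and
idempotent. -/
theorem norm_toL2_proj_le (g : C_c(S, ℂ)) :
    ‖T.toL2 lam u (T.proj χ g).1‖ ≤ ‖T.toL2 lam u g‖ := by
  have h : inner ℂ (T.toL2 lam u (T.proj χ g).1) (T.toL2 lam u (T.proj χ g).1) =
      inner ℂ (T.toL2 lam u g) (T.toL2 lam u (T.proj χ g).1) := by
    rw [inner_toL2, inner_toL2]
    exact T.integral_conj_mul_proj lam χ u g (T.proj χ g)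
  have h1 := norm_inner_le_norm (𝕜 := ℂ) (T.toL2 lam u g) (T.toL2 lam u (T.proj χ g).1)
  rw [← h, inner_self_eq_norm_sq_to_K] at h1
  simp only [norm_pow, RCLike.norm_ofReal, abs_norm] at h1
  rcases (norm_nonneg (T.toL2 lam u (T.proj χ g).1)).eq_or_lt with h0 | h0
  · rw [← h0]; exact norm_nonneg _
  · nlinarith

/-- Left convolution by `f` on `C_c(S)`. -/
noncomputable def convLin (f : C_c(S, ℂ)) : C_c(S, ℂ) →ₗ[ℂ] C_c(S, ℂ) where
  toFun := T.convCc lam f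
  map_add' g h := by
    ext σ
    have hi : ∀ g : C_c(S, ℂ), Integrable (fun τ => f τ * g (mul (inv τ) σ))
        (T.haar lam (T.base σ)) := fun g => by
      refine integrable_of_continuousOn_fiber (T.isClosed_fiber _) (T.haar_compl_fiber lam _)
        (f.continuous.continuousOn.mul (g.continuous.comp_continuousOn (continuousOn_gmul
          continuous_inv.continuousOn continuousOn_const fun τ hτ => T.composable_inv hτ)))
        f.hasCompactSupport.isCompact fun τ _ hτ => ?_
      rw [image_eq_zero_of_notMem_tsupport hτ, zero_mul]
    refine Eq.trans ?_ (integral_add (hi g) (hi h))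
    exact integral_congr_ae (Filter.Eventually.of_forall fun τ => mul_add _ _ _)
  map_smul' c g := by
    ext σ
    refine Eq.trans ?_ (integral_const_mul c _)
    refine integral_congr_ae (Filter.Eventually.of_forall fun τ => ?_)
    change f τ * (c * g _) = _
    ring

/-- Convolution on `C_c(S; G; χ)`. -/
noncomputable def convE (f g : T.equivariantCc χ) : T.equivariantCc χ :=
  ⟨T.convCc lam f.1 g.1, T.conv_act lam f.1 g.2⟩

variable {χ u}

/-- `Ind δ_u (f)` is characterised by its values on the classes of functions in `C_c(S)`. -/
theorem isInd_iff {f : T.equivariantCc χ} {A : T.L2 lam u →L[ℂ] T.L2 lam u} :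
    T.IsInd χ lam u f A ↔ ∀ g, A (T.toL2 lam u g) = T.toL2 lam u (T.convCc lam f.1 g) := by
  constructor
  · intro h g
    exact T.eq_toL2 lam u (h g _ (T.coeFn_toL2 lam u g))
  · intro h g ξ hξ
    rw [T.eq_toL2 lam u hξ, h g]
    exact T.coeFn_toL2 lam u _

/-- `Ind δ_u (f)` factors through the isotypic projection and takes values in the isotypic part. -/
theorem IsInd.apply_toL2 {f : T.equivariantCc χ} {A : T.L2 lam u →L[ℂ] T.L2 lam u}
    (h : T.IsInd χ lam u f A) (g : C_c(S, ℂ)) :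
    A (T.toL2 lam u g) = T.toL2 lam u (T.convE χ lam f (T.proj χ g)).1 := by
  rw [(T.isInd_iff lam).1 h g]
  congr 1
  ext σ
  exact (T.conv_proj lam χ f g σ).symm

variable (χ)

theorem exists_norm_bound (f : C_c(S, ℂ)) : ∃ C : ℝ, 0 ≤ C ∧
    (∀ u, ∫ σ, ‖f σ‖ ∂(T.haar lam u) ≤ C) ∧ ∀ u, ∫ σ, ‖f (inv σ)‖ ∂(T.haar lam u) ≤ C := by
  obtain ⟨C₁, h1⟩ := T.exists_integral_norm_le lam f
  obtain ⟨C₂, h2⟩ := T.exists_integral_norm_le lam (invCc f)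
  exact ⟨max 0 (max C₁ C₂), le_max_left _ _,
    fun u => (h1 u).trans ((le_max_left _ _).trans (le_max_right _ _)),
    fun u => (h2 u).trans ((le_max_right _ _).trans (le_max_right _ _))⟩

/-- The operators `Ind δ_u (f)` exist and are bounded uniformly in `u`. -/
theorem exists_reducedImage (f : T.equivariantCc χ) : ∃ x, T.IsReducedImage χ lam f x := by
  obtain ⟨C, hC, h1, h2⟩ := T.exists_norm_bound lam f.1
  have hb : ∀ u g, ‖(T.toL2 lam u ∘ₗ T.convLin lam f.1) g‖ ≤ C * ‖T.toL2 lam u g‖ := by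
    intro u g
    refine (pow_le_pow_iff_left₀ (norm_nonneg _) (by positivity) two_ne_zero).1 ?_
    rw [mul_pow, norm_toL2_sq]
    refine le_trans (le_of_eq ?_) (T.integral_norm_conv_sq_le lam f.1 g h1 h2 u)
    exact T.norm_toL2_sq lam u _
  let A : ∀ u, T.L2 lam u →L[ℂ] T.L2 lam u := fun u =>
    (T.toL2 lam u ∘ₗ T.convLin lam f.1).extendOfNorm (T.toL2 lam u)
  have hA : ∀ u, ‖A u‖ ≤ C := fun u => ContinuousLinearMap.opNorm_le_bound _ hC fun ξ =>
    LinearMap.norm_extendOfNorm_apply_le (T.denseRange_toL2 lam u) C (hb u) ξ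
  refine ⟨⟨A, memℓp_infty ⟨C, ?_⟩⟩, fun u => (T.isInd_iff lam).2 fun g => ?_⟩
  · rintro _ ⟨u, rfl⟩
    exact hA u
  · exact LinearMap.extendOfNorm_eq (T.denseRange_toL2 lam u) ⟨C, hb u⟩ g

theorem normI_ne_top (f : C_c(S, ℂ)) : T.normI lam f ≠ ∞ := by
  obtain ⟨C, -, h1, h2⟩ := T.exists_norm_bound lam f
  have key : ∀ (f : C_c(S, ℂ)) u, (∫ σ, ‖f σ‖ ∂(T.haar lam u) ≤ C) →
      ∫⁻ σ, ‖f σ‖ₑ ∂(T.haar lam u) ≤ ENNReal.ofReal C := fun f u h => by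
    rw [← ofReal_integral_norm_eq_lintegral_enorm f.integrable]
    exact ENNReal.ofReal_le_ofReal h
  refine ne_top_of_le_ne_top (ENNReal.ofReal_ne_top (r := C)) (max_le (iSup_le fun u => ?_)
    (iSup_le fun u => key f u (h1 u)))
  rw [lintegral_haarInv]
  exact key (invCc f) u (h2 u)

theorem exists_fullImage (f : T.equivariantCc χ) : ∃ x, T.IsFullImage χ lam f x := by
  refine ⟨⟨fun L => L.L f, memℓp_infty ⟨(T.normI lam f.1).toReal, ?_⟩⟩, fun L => rfl⟩
  rintro _ ⟨L, rfl⟩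
  have := ENNReal.toReal_mono (T.normI_ne_top lam f.1) (L.norm_le f)
  simpa using this

end SquareIntegrable

section Transport

variable {Γ Γ' : Type*} {G : Type u} {S S' : Type v} [CommGroup Γ] [TopologicalSpace Γ]
  [IsTopologicalGroup Γ] [CompactSpace Γ] [CommGroup Γ'] [TopologicalSpace Γ']
  [IsTopologicalGroup Γ'] [CompactSpace Γ'] [TopologicalSpace G] [TopologicalGroupoid G]
  [TopologicalSpace S] [TopologicalGroupoid S] [TopologicalSpace S'] [TopologicalGroupoid S']
  [T2Space G] [T2Space S] [LocallyCompactSpace S] [T2Space S'] [LocallyCompactSpace S']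
  {T : Twist Γ G S} {T' : Twist Γ' G S'} {χ : Γ →ₜ* Circle} {χ' : Γ' →ₜ* Circle}
  {lam : HaarSystem G}

variable (lam) in
/-- A linear isomorphism between spaces of equivariant functions is compatible with all the
structure that enters the construction of the twisted groupoid C⋆-algebras: convolution,
involution, `I`-norm, and the inner products of `L²(S_u, μ_u)`. -/
structure IsCompatible (e : T.equivariantCc χ ≃ₗ[ℂ] T'.equivariantCc χ') : Prop where
  conv_iff : ∀ f g h, (∀ σ, h.1 σ = T.conv lam f.1 g.1 σ) ↔
    ∀ σ', (e h).1 σ' = T'.conv lam (e f).1 (e g).1 σ'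
  star_iff : ∀ f h, (∀ σ, h.1 σ = starRingEnd ℂ (f.1 (inv σ))) ↔
    ∀ σ', (e h).1 σ' = starRingEnd ℂ ((e f).1 (inv σ'))
  normI_eq : ∀ f, T'.normI lam (e f).1 = T.normI lam f.1
  inner_eq : ∀ u f g, inner ℂ (T'.toL2 lam u (e f).1) (T'.toL2 lam u (e g).1) =
    inner ℂ (T.toL2 lam u f.1) (T.toL2 lam u g.1)

namespace IsCompatible

variable {e : T.equivariantCc χ ≃ₗ[ℂ] T'.equivariantCc χ'}

theorem symm (he : IsCompatible lam e) : IsCompatible lam e.symm where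
  conv_iff f g h := by simpa using (he.conv_iff (e.symm f) (e.symm g) (e.symm h)).symm
  star_iff f h := by simpa using (he.star_iff (e.symm f) (e.symm h)).symm
  normI_eq f := by simpa using (he.normI_eq (e.symm f)).symm
  inner_eq u f g := by simpa using (he.inner_eq u (e.symm f) (e.symm g)).symm

/-- Representations are pulled back along a compatible isomorphism. -/
noncomputable def pull (he : IsCompatible lam e) (L : T'.Rep χ' lam) : T.Rep χ lam where
  H := L.H
  L := L.L ∘ₗ e.toLinearMap
  map_conv f g h hh := L.map_conv _ _ _ ((he.conv_iff f g h).1 hh)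
  map_star f h hh := L.map_star _ _ ((he.star_iff f h).1 hh)
  norm_le f := (L.norm_le (e f)).trans_eq (he.normI_eq f)

/-- Pulling back along `e` and along `e⁻¹` are inverse to each other, as an equality of
representations. -/
theorem pull_pull (he : IsCompatible lam e) (L : T.Rep χ lam) : he.pull (he.symm.pull L) = L := by
  rcases L with @⟨H, hn, hi, hc, L, h1, h2, h3⟩
  have h : (L ∘ₗ e.symm.toLinearMap) ∘ₗ e.toLinearMap = L :=
    LinearMap.ext fun f => congrArg L (e.symm_apply_apply f)
  change Rep.mk H ((L ∘ₗ e.symm.toLinearMap) ∘ₗ e.toLinearMap) _ _ _ = _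
  congr 1

/-- The map between the ambient C⋆-algebras of the full twisted groupoid C⋆-algebras that a
compatible isomorphism induces. -/
noncomputable def fullMap (he : IsCompatible lam e) :
    T.FullAmbient χ lam →L[ℂ] T'.FullAmbient χ' lam :=
  familyMap (E := fun L : T.Rep χ lam => L.H) (H := fun L : T'.Rep χ' lam => L.H) he.pull
    (fun L => (LinearMap.id : (L.H →L[ℂ] L.H) →ₗ[ℂ] (L.H →L[ℂ] L.H))) fun _ _ => le_rfl

theorem fullMap_fullMap (he : IsCompatible lam e) (x : T.FullAmbient χ lam) :
    he.symm.fullMap (he.fullMap x) = x := by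
  refine BoundedFamily.ext fun L => ?_
  -- The two components live on the same Hilbert space only after `pull_pull` is used.
  have h : ∀ L', L' = L → HEq (x L') (x L) := by rintro _ rfl; rfl
  exact eq_of_heq (h _ (he.pull_pull L))

theorem isFullImage_fullMap (he : IsCompatible lam e) {f : T.equivariantCc χ}
    {x : T.FullAmbient χ lam} (hx : T.IsFullImage χ lam f x) :
    T'.IsFullImage χ' lam (e f) (he.fullMap x) := fun L => hx (he.pull L)

theorem exists_fullCStar_equiv (he : IsCompatible lam e) :
    ∃ Φ : T.FullCStar χ lam ≃⋆ₐ[ℂ] T'.FullCStar χ' lam,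
      ∀ f, ∃ x, T.IsFullImage χ lam f x.val ∧ T'.IsFullImage χ' lam (e f) (Φ x).val := by
  obtain ⟨Φ, hΦ⟩ := exists_cstarClosure_equiv (s := {x | ∃ f, T.IsFullImage χ lam f x})
    (t := {x | ∃ f, T'.IsFullImage χ' lam f x}) (F := he.fullMap) (F' := he.symm.fullMap)
    (fun _ => rfl) (fun _ => rfl) (fun x ⟨f, hx⟩ => ⟨e f, he.isFullImage_fullMap hx⟩)
    (fun x ⟨f, hx⟩ => ⟨e.symm f, he.symm.isFullImage_fullMap hx⟩)
    (fun x _ => he.fullMap_fullMap x) (fun x _ => he.symm.fullMap_fullMap x)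
    (fun _ _ _ => ⟨rfl, rfl⟩) (fun _ _ _ => ⟨rfl, rfl⟩)
  refine ⟨Φ, fun f => ?_⟩
  obtain ⟨x, hx⟩ := T.exists_fullImage χ lam f
  refine ⟨⟨x, subset_cstarClosure _ ⟨f, hx⟩⟩, hx, ?_⟩
  have h := hΦ ⟨x, subset_cstarClosure _ ⟨f, hx⟩⟩
  change T'.IsFullImage χ' lam (e f) (Φ _ : T'.FullAmbient χ' lam)
  rw [h]
  exact he.isFullImage_fullMap hx

end IsCompatible

end Transport

end Twist

/-! ### The reduced C⋆-algebra -/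

namespace Twist

namespace IsCompatible

variable {Γ Γ' : Type*} {G : Type u} {S S' : Type v} [CommGroup Γ] [TopologicalSpace Γ]
  [IsTopologicalGroup Γ] [CompactSpace Γ] [CommGroup Γ'] [TopologicalSpace Γ']
  [IsTopologicalGroup Γ'] [CompactSpace Γ'] [TopologicalSpace G] [TopologicalGroupoid G]
  [TopologicalSpace S] [TopologicalGroupoid S] [TopologicalSpace S'] [TopologicalGroupoid S']
  [T2Space G] [T2Space S] [LocallyCompactSpace S] [T2Space S'] [LocallyCompactSpace S']
  {T : Twist Γ G S} {T' : Twist Γ' G S'} {χ : Γ →ₜ* Circle} {χ' : Γ' →ₜ* Circle}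
  {lam : HaarSystem G} {e : T.equivariantCc χ ≃ₗ[ℂ] T'.equivariantCc χ'}

theorem norm_toL2 (he : IsCompatible lam e) (u : units G) (f : T.equivariantCc χ) :
    ‖T'.toL2 lam u (e f).1‖ = ‖T.toL2 lam u f.1‖ := by
  rw [norm_eq_sqrt_re_inner (𝕜 := ℂ), norm_eq_sqrt_re_inner (𝕜 := ℂ), he.inner_eq]

theorem norm_toL2_proj_le (he : IsCompatible lam e) (u : units G) (g : C_c(S, ℂ)) :
    ‖(T'.toL2 lam u ∘ₗ (T'.equivariantCc χ').subtype ∘ₗ e.toLinearMap ∘ₗ T.proj χ) g‖ ≤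
      1 * ‖T.toL2 lam u g‖ := by
  rw [one_mul]
  exact (he.norm_toL2 u (T.proj χ g)).trans_le (T.norm_toL2_proj_le χ lam u g)

/-- The partial isometry `L²(S_u, μ_u) → L²(S'_u, μ'_u)` whose initial and final spaces are the
isotypic parts, and which is given by `e` between these. -/
noncomputable def transfer (_ : IsCompatible lam e) (u : units G) :
    T.L2 lam u →L[ℂ] T'.L2 lam u :=
  (T'.toL2 lam u ∘ₗ (T'.equivariantCc χ').subtype ∘ₗ e.toLinearMap ∘ₗ T.proj χ).extendOfNorm
    (T.toL2 lam u)

theorem transfer_toL2 (he : IsCompatible lam e) (u : units G) (g : C_c(S, ℂ)) :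
    he.transfer u (T.toL2 lam u g) = T'.toL2 lam u (e (T.proj χ g)).1 :=
  LinearMap.extendOfNorm_eq (T.denseRange_toL2 lam u) ⟨1, he.norm_toL2_proj_le u⟩ g

theorem transfer_toL2_coe (he : IsCompatible lam e) (u : units G) (f : T.equivariantCc χ) :
    he.transfer u (T.toL2 lam u f.1) = T'.toL2 lam u (e f).1 := by
  rw [transfer_toL2, proj_of_mem]

theorem norm_transfer_le (he : IsCompatible lam e) (u : units G) : ‖he.transfer u‖ ≤ 1 :=
  ContinuousLinearMap.opNorm_le_bound _ zero_le_one fun ξ =>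
    LinearMap.norm_extendOfNorm_apply_le (T.denseRange_toL2 lam u) 1 (he.norm_toL2_proj_le u) ξ

/-- On `C_c(S; G; χ)`, the inner product with `f ∈ C_c(S)` is the one with its isotypic part. -/
theorem inner_toL2_proj (T : Twist Γ G S) (u : units G) (g : C_c(S, ℂ)) (f : T.equivariantCc χ) :
    inner ℂ (T.toL2 lam u (T.proj χ g).1) (T.toL2 lam u f.1) =
      inner ℂ (T.toL2 lam u g) (T.toL2 lam u f.1) := by
  rw [inner_toL2, inner_toL2]
  exact T.integral_conj_mul_proj lam χ u g f

/-- The adjoint of the partial isometry of `e` is the partial isometry of `e⁻¹`. -/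
theorem adjoint_transfer (he : IsCompatible lam e) (u : units G) :
    he.symm.transfer u = ContinuousLinearMap.adjoint (he.transfer u) := by
  rw [ContinuousLinearMap.eq_adjoint_iff]
  intro ξ η
  refine (T'.denseRange_toL2 lam u).induction_on
    (p := fun ξ => inner ℂ (he.symm.transfer u ξ) η = inner ℂ ξ (he.transfer u η)) ξ
    (isClosed_eq (by fun_prop) (by fun_prop)) fun g' => ?_
  refine (T.denseRange_toL2 lam u).induction_on
    (p := fun η => inner ℂ (he.symm.transfer u (T'.toL2 lam u g')) η =
      inner ℂ (T'.toL2 lam u g') (he.transfer u η)) η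
    (isClosed_eq (by fun_prop) (by fun_prop)) fun g => ?_
  rw [transfer_toL2, transfer_toL2, ← inner_toL2_proj T' u g' (e (T.proj χ g)),
    ← inner_conj_symm, ← inner_toL2_proj T u g, inner_conj_symm, ← he.inner_eq,
    LinearEquiv.apply_symm_apply]

theorem adjoint_transfer_symm (he : IsCompatible lam e) (u : units G) :
    ContinuousLinearMap.adjoint (he.symm.transfer u) = he.transfer u := by
  rw [adjoint_transfer, ContinuousLinearMap.adjoint_adjoint]

theorem transfer_transfer (he : IsCompatible lam e) (u : units G) (f : T.equivariantCc χ) :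
    he.symm.transfer u (he.transfer u (T.toL2 lam u f.1)) = T.toL2 lam u f.1 := by
  rw [transfer_toL2_coe, transfer_toL2_coe, LinearEquiv.symm_apply_apply]

theorem map_convE (he : IsCompatible lam e) (f g : T.equivariantCc χ) :
    e (T.convE χ lam f g) = T'.convE χ' lam (e f) (e g) := by
  ext σ'
  exact (he.conv_iff f g (T.convE χ lam f g)).1 (fun _ => rfl) σ'

section

variable {u : units G} {f : T.equivariantCc χ} {A : T.L2 lam u →L[ℂ] T.L2 lam u}

theorem transfer_transfer_ind (he : IsCompatible lam e) (h : T.IsInd χ lam u f A) :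
    (he.symm.transfer u ∘L he.transfer u) ∘L A = A := by
  refine ContinuousLinearMap.coeFn_injective ((T.denseRange_toL2 lam u).equalizer (by fun_prop)
    (by fun_prop) (funext fun g => ?_))
  simp only [Function.comp_apply, ContinuousLinearMap.comp_apply]
  rw [h.apply_toL2, transfer_transfer]

theorem ind_transfer_transfer (he : IsCompatible lam e) (h : T.IsInd χ lam u f A) :
    A ∘L (he.symm.transfer u ∘L he.transfer u) = A := by
  refine ContinuousLinearMap.coeFn_injective ((T.denseRange_toL2 lam u).equalizer (by fun_prop)
    (by fun_prop) (funext fun g => ?_))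
  simp only [Function.comp_apply, ContinuousLinearMap.comp_apply]
  rw [transfer_toL2, transfer_toL2_coe, LinearEquiv.symm_apply_apply, h.apply_toL2, h.apply_toL2,
    proj_of_mem]

theorem isInd_transfer (he : IsCompatible lam e) (h : T.IsInd χ lam u f A) :
    T'.IsInd χ' lam u (e f) (he.transfer u ∘L A ∘L he.symm.transfer u) := by
  rw [isInd_iff]
  intro g'
  simp only [ContinuousLinearMap.comp_apply]
  rw [transfer_toL2, h.apply_toL2, proj_of_mem, transfer_toL2_coe, he.map_convE,
    LinearEquiv.apply_symm_apply]
  congr 1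
  ext σ'
  exact T'.conv_proj lam χ' (e f) g' σ'

end

/-- The map `x ↦ V x V^*`, where `V` is the partial isometry `transfer`, between the ambient
C⋆-algebras of the reduced twisted groupoid C⋆-algebras. -/
noncomputable def reducedMap (he : IsCompatible lam e) :
    T.ReducedAmbient lam →L[ℂ] T'.ReducedAmbient lam :=
  familyMap (E := fun u => T.L2 lam u) (H := fun u => T'.L2 lam u) id
    (fun u =>
      { toFun := fun A => he.transfer u ∘L A ∘L he.symm.transfer u
        map_add' := fun A B => by ext1 ξ; simp
        map_smul' := fun c A => by ext1 ξ; simp })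
    fun u A => by
      change ‖he.transfer u ∘L A ∘L he.symm.transfer u‖ ≤ ‖A‖
      calc _ ≤ ‖he.transfer u‖ * (‖A‖ * ‖he.symm.transfer u‖) :=
            (ContinuousLinearMap.opNorm_comp_le _ _).trans
              (by gcongr; exact ContinuousLinearMap.opNorm_comp_le _ _)
        _ ≤ 1 * (‖A‖ * 1) := by
            gcongr
            · exact he.norm_transfer_le u
            · exact he.symm.norm_transfer_le u
        _ = ‖A‖ := by ring

theorem reducedMap_apply (he : IsCompatible lam e) (x : T.ReducedAmbient lam) (u : units G) :
    he.reducedMap x u = he.transfer u ∘L x u ∘L he.symm.transfer u := rfl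

theorem reducedMap_star (he : IsCompatible lam e) (x : T.ReducedAmbient lam) :
    he.reducedMap (star x) = star (he.reducedMap x) := by
  refine BoundedFamily.ext fun u => ?_
  rw [BoundedFamily.star_apply, reducedMap_apply, reducedMap_apply, BoundedFamily.star_apply,
    ContinuousLinearMap.star_eq_adjoint, ContinuousLinearMap.star_eq_adjoint,
    ContinuousLinearMap.adjoint_comp, ContinuousLinearMap.adjoint_comp, adjoint_transfer_symm,
    ← adjoint_transfer]
  rfl

/-- As `V^* V` acts as the identity on both sides of the operators `Ind δ_u (f)`,
`V (x y) V^* = (V x V^*) (V y V^*)` whenever `x` is a family of such operators. -/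
theorem multiplicativeAt_reducedMap (he : IsCompatible lam e) {f : T.equivariantCc χ}
    {x : T.ReducedAmbient lam} (hx : T.IsReducedImage χ lam f x) :
    MultiplicativeAt he.reducedMap x := by
  intro y
  constructor <;> refine BoundedFamily.ext fun u => ?_
  · rw [BoundedFamily.mul_apply, reducedMap_apply, reducedMap_apply, reducedMap_apply,
      BoundedFamily.mul_apply]
    conv_lhs => rw [← he.ind_transfer_transfer (hx u)]
    rfl
  · rw [BoundedFamily.mul_apply, reducedMap_apply, reducedMap_apply, reducedMap_apply,
      BoundedFamily.mul_apply]
    conv_lhs => rw [← he.transfer_transfer_ind (hx u)]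
    rfl

theorem isReducedImage_reducedMap (he : IsCompatible lam e) {f : T.equivariantCc χ}
    {x : T.ReducedAmbient lam} (hx : T.IsReducedImage χ lam f x) :
    T'.IsReducedImage χ' lam (e f) (he.reducedMap x) := fun u => he.isInd_transfer (hx u)

theorem reducedMap_reducedMap (he : IsCompatible lam e) {f : T.equivariantCc χ}
    {x : T.ReducedAmbient lam} (hx : T.IsReducedImage χ lam f x) :
    he.symm.reducedMap (he.reducedMap x) = x := by
  refine BoundedFamily.ext fun u => ?_
  rw [reducedMap_apply, reducedMap_apply]
  conv_rhs => rw [← he.ind_transfer_transfer (hx u), ← he.transfer_transfer_ind (hx u)]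
  rfl

theorem exists_reducedCStar_equiv (he : IsCompatible lam e) :
    ∃ Φ : T.ReducedCStar χ lam ≃⋆ₐ[ℂ] T'.ReducedCStar χ' lam,
      ∀ f, ∃ x, T.IsReducedImage χ lam f x.val ∧ T'.IsReducedImage χ' lam (e f) (Φ x).val := by
  obtain ⟨Φ, hΦ⟩ := exists_cstarClosure_equiv (s := {x | ∃ f, T.IsReducedImage χ lam f x})
    (t := {x | ∃ f, T'.IsReducedImage χ' lam f x}) (F := he.reducedMap) (F' := he.symm.reducedMap)
    he.reducedMap_star he.symm.reducedMap_star
    (fun x ⟨f, hx⟩ => ⟨e f, he.isReducedImage_reducedMap hx⟩)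
    (fun x ⟨f, hx⟩ => ⟨e.symm f, he.symm.isReducedImage_reducedMap hx⟩)
    (fun x ⟨_, hx⟩ => he.reducedMap_reducedMap hx)
    (fun x ⟨_, hx⟩ => he.symm.reducedMap_reducedMap hx)
    (fun x ⟨_, hx⟩ => he.multiplicativeAt_reducedMap hx)
    (fun x ⟨_, hx⟩ => he.symm.multiplicativeAt_reducedMap hx)
  refine ⟨Φ, fun f => ?_⟩
  obtain ⟨x, hx⟩ := T.exists_reducedImage χ lam f
  refine ⟨⟨x, subset_cstarClosure _ ⟨f, hx⟩⟩, hx, ?_⟩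
  have h := hΦ ⟨x, subset_cstarClosure _ ⟨f, hx⟩⟩
  change T'.IsReducedImage χ' lam (e f) (Φ _ : T'.ReducedAmbient lam)
  rw [h]
  exact he.isReducedImage_reducedMap hx

end IsCompatible

end Twist

/-! ### The isomorphism between equivariant functions on a twist and on its push-out -/

namespace Twist

namespace Push

variable {Γ : Type w} {G : Type u} {S : Type v} [CommGroup Γ] [TopologicalSpace Γ]
  [IsTopologicalGroup Γ] [TopologicalSpace G] [TopologicalGroupoid G]
  [TopologicalSpace S] [TopologicalGroupoid S] (T : Twist Γ G S) (χ : Γ →ₜ* Circle)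

/-- The canonical homomorphism from a twist to its push-out along a character. -/
noncomputable def toPush (σ : S) : T.Push χ := mk T χ 1 σ

theorem hom_toPush : IsGroupoidHom (toPush T χ) := fun σ τ h =>
  ⟨(composable_mk T χ).2 h, by
    rw [toPush, toPush, toPush, mul_mk T χ 1 1 h, one_mul]⟩

theorem continuous_toPush : Continuous (toPush T χ) :=
  continuous_mk T χ continuous_const continuous_id

theorem toPush_ι (u : units G) (α : Γ) : toPush T χ (T.ι (u, α)) = inc T χ (u, χ α) := by
  rw [toPush, ← act_ι_one, mk_act, one_mul]
  rfl

theorem norm_apply_act (f : T.equivariantCc χ) (α : Γ) (σ : S) : ‖f.1 (T.act α σ)‖ = ‖f.1 σ‖ := by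
  rw [f.2 α, norm_mul, Circle.norm_coe, one_mul]

variable [CompactSpace Γ] [T2Space S]

theorem base_mk (z : Circle) (σ : S) : (twist T χ).base (mk T χ z σ) = T.base σ := rfl

theorem act_mk (w z : Circle) (σ : S) :
    (twist T χ).act w (mk T χ z σ) = mk T χ (w * z) σ := by
  change mul (inc T χ (T.base σ, w)) (mk T χ z σ) = _
  rw [inc_base, mul_mk T χ w z (s_r σ), r_mul_self]

/-- The equivariant extension `[z, σ] ↦ z f(σ)` of `f ∈ C_c(S; G; χ)` to the push-out. -/
noncomputable def extend (f : T.equivariantCc χ) :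
    (twist T χ).equivariantCc (ContinuousMonoidHom.id Circle) :=
  ⟨{ toFun := fun x => Quotient.lift (fun p : Circle × S => (p.1 : ℂ) * f.1 p.2) (by
        rintro p q ⟨α, rfl⟩
        change (p.1 : ℂ) * f.1 p.2 = ((p.1 * (χ α)⁻¹ : Circle) : ℂ) * f.1 (T.act α p.2)
        rw [f.2 α, Circle.coe_mul, Circle.coe_inv, mul_assoc,
          inv_mul_cancel_left₀ (Circle.coe_ne_zero _)]) x
     continuous_toFun := by
      rw [(isQuotientMap_mk T χ).continuous_iff]
      exact (continuous_subtype_val.comp continuous_fst).mul (f.1.continuous.comp continuous_snd)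
     hasCompactSupport' := by
      refine HasCompactSupport.intro ((isCompact_univ.prod f.1.hasCompactSupport.isCompact).image
        (isQuotientMap_mk T χ).continuous) fun x hx => ?_
      obtain ⟨z, σ, rfl⟩ := exists_mk T χ x
      change (z : ℂ) * f.1 σ = 0
      rw [image_eq_zero_of_notMem_tsupport fun h => hx ⟨(z, σ), ⟨Set.mem_univ _, h⟩, rfl⟩,
        mul_zero] }, by
    intro w x
    obtain ⟨z, σ, rfl⟩ := exists_mk T χ x
    rw [act_mk]
    change ((w * z : Circle) : ℂ) * f.1 σ = (w : ℂ) * ((z : ℂ) * f.1 σ)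
    rw [Circle.coe_mul, mul_assoc]⟩

theorem extend_mk (f : T.equivariantCc χ) (z : Circle) (σ : S) :
    (extend T χ f).1 (mk T χ z σ) = z * f.1 σ := rfl

/-- The restriction of an equivariant function on the push-out along `toPush`. -/
noncomputable def restrict (f : (twist T χ).equivariantCc (ContinuousMonoidHom.id Circle)) :
    T.equivariantCc χ :=
  ⟨{ toFun := fun σ => f.1 (toPush T χ σ)
     continuous_toFun := f.1.continuous.comp (continuous_toPush T χ)
     hasCompactSupport' := HasCompactSupport.intro (T.isProperMap_π.isCompact_preimage
        (f.1.hasCompactSupport.isCompact.image (continuous_pr T χ))) fun σ hσ =>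
      image_eq_zero_of_notMem_tsupport fun h => hσ ⟨_, h, rfl⟩ }, by
    intro α σ
    change f.1 (mk T χ 1 (T.act α σ)) = χ α * f.1 (mk T χ 1 σ)
    rw [mk_act, mul_comm, ← act_mk]
    exact f.2 (χ α) _⟩

theorem restrict_apply (f : (twist T χ).equivariantCc (ContinuousMonoidHom.id Circle)) (σ : S) :
    (restrict T χ f).1 σ = f.1 (mk T χ 1 σ) := rfl

theorem apply_mk (f : (twist T χ).equivariantCc (ContinuousMonoidHom.id Circle)) (z : Circle)
    (σ : S) : f.1 (mk T χ z σ) = z * f.1 (mk T χ 1 σ) := by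
  have := f.2 z (mk T χ 1 σ)
  rwa [act_mk, mul_one] at this

/-- The isomorphism `C_c(Σ; G; χ) ≅ C_c(Σ'; G; id)`. -/
noncomputable def equivariantEquiv : T.equivariantCc χ ≃ₗ[ℂ]
    (twist T χ).equivariantCc (ContinuousMonoidHom.id Circle) where
  toFun := extend T χ
  invFun := restrict T χ
  left_inv f := by
    ext σ
    rw [restrict_apply, extend_mk, Circle.coe_one, one_mul]
  right_inv f := by
    ext x
    obtain ⟨z, σ, rfl⟩ := exists_mk T χ x
    rw [extend_mk, restrict_apply, ← apply_mk]
  map_add' f g := by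
    ext x
    obtain ⟨z, σ, rfl⟩ := exists_mk T χ x
    exact mul_add _ _ _
  map_smul' c f := by
    ext x
    obtain ⟨z, σ, rfl⟩ := exists_mk T χ x
    exact mul_left_comm _ _ _

theorem equivariantEquiv_mk (f : T.equivariantCc χ) (z : Circle) (σ : S) :
    (equivariantEquiv T χ f).1 (mk T χ z σ) = z * f.1 σ := rfl

/-- Invariant functions have the same averages over corresponding orbits in the twist and in its
push-out. -/
theorem avg_eq {φ : S → ℂ} {φ' : T.Push χ → ℂ} {c : ℂ} {σ : S}
    (h : ∀ α, φ (T.act α σ) = φ σ) (h' : ∀ z, φ' (mk T χ z σ) = c * φ σ) :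
    (twist T χ).avg φ' (T.π σ) = c * T.avg φ (T.π σ) := by
  rw [T.avg_π_of_invariant h, ← h' 1]
  refine (twist T χ).avg_π_of_invariant (σ := mk T χ 1 σ) fun z => ?_
  rw [act_mk, h', h']

variable [T2Space G] [LocallyCompactSpace S] (lam : HaarSystem G)

theorem integral_haar_eq {φ : C_c(S, ℂ)} {φ' : C_c(T.Push χ, ℂ)}
    (h : ∀ α σ, φ (T.act α σ) = φ σ) (h' : ∀ z σ, φ' (mk T χ z σ) = φ σ) (u : units G) :
    ∫ x, φ' x ∂((twist T χ).haar lam u) = ∫ σ, φ σ ∂(T.haar lam u) := by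
  rw [integral_haar, integral_haar]
  congr 1 with γ
  obtain ⟨σ, rfl⟩ := T.isQuotientMap_π.surjective γ
  rw [avg_eq T χ (c := 1) (fun α => h α σ) (fun z => by rw [h', one_mul]), one_mul]

theorem integral_haarInv_eq {φ : C_c(S, ℂ)} {φ' : C_c(T.Push χ, ℂ)}
    (h : ∀ α σ, φ (T.act α σ) = φ σ) (h' : ∀ z σ, φ' (mk T χ z σ) = φ σ) (u : units G) :
    ∫ x, φ' x ∂((twist T χ).haarInv lam u) = ∫ σ, φ σ ∂(T.haarInv lam u) := by
  rw [integral_haarInv, integral_haarInv]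
  refine integral_haar_eq T χ lam (φ := invCc φ) (φ' := invCc φ') (fun α σ => ?_)
    (fun z σ => h' _ _) u
  change φ (inv (T.act α σ)) = φ (inv σ)
  rw [inv_act, h]

/-- The isomorphism respects convolution: both integrands are constant on orbits, and descend to the
same function on `G`. -/
theorem conv_mk (f g : T.equivariantCc χ) (z : Circle) (σ : S) :
    (twist T χ).conv lam (equivariantEquiv T χ f).1 (equivariantEquiv T χ g).1 (mk T χ z σ) =
      z * T.conv lam f.1 g.1 σ := by
  rw [conv_eq_integral_avg, conv_eq_integral_avg, base_mk, ← integral_const_mul]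
  refine integral_congr_ae ?_
  filter_upwards [lam.ae_rng _] with γ hγ
  obtain ⟨τ, rfl⟩ := T.isQuotientMap_π.surjective γ
  have hτ : T.base τ = T.base σ := by rw [base_eq_rng, hγ]
  refine avg_eq T χ (φ := fun τ => f.1 τ * g.1 (mul (inv τ) σ))
    (fun α => T.conv_integrand_act f.2 g.2 hτ α) fun w => ?_
  rw [inv_mk, mul_mk T χ _ _ (T.composable_inv hτ), equivariantEquiv_mk, equivariantEquiv_mk,
    Circle.coe_mul, Circle.coe_inv]
  field_simp [Circle.coe_ne_zero]

theorem lintegral_haar_eq {f : C_c(S, ℂ)} {f' : C_c(T.Push χ, ℂ)}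
    (h : ∀ α σ, ‖f (T.act α σ)‖ = ‖f σ‖) (h' : ∀ z σ, ‖f' (mk T χ z σ)‖ = ‖f σ‖) (u : units G) :
    ∫⁻ x, ‖f' x‖ₑ ∂((twist T χ).haar lam u) = ∫⁻ σ, ‖f σ‖ₑ ∂(T.haar lam u) := by
  rw [← ofReal_integral_norm_eq_lintegral_enorm f'.integrable,
    ← ofReal_integral_norm_eq_lintegral_enorm f.integrable]
  congr 1
  have := integral_haar_eq T χ lam (φ := absCc f) (φ' := absCc f')
    (fun α σ => by rw [absCc_apply, absCc_apply, h])
    (fun z σ => by rw [absCc_apply, absCc_apply, h']) u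
  simp_rw [absCc_apply] at this
  rw [integral_complex_ofReal, integral_complex_ofReal] at this
  exact_mod_cast this

theorem isCompatible_equivariantEquiv : IsCompatible lam (equivariantEquiv T χ) where
  conv_iff f g h := by
    constructor
    · intro H x
      obtain ⟨z, σ, rfl⟩ := exists_mk T χ x
      rw [conv_mk, equivariantEquiv_mk, H]
    · intro H σ
      have := H (mk T χ 1 σ)
      rwa [conv_mk, equivariantEquiv_mk, Circle.coe_one, one_mul, one_mul] at this
  star_iff f h := by
    have hstar : ∀ z σ, starRingEnd ℂ ((equivariantEquiv T χ f).1 (inv (mk T χ z σ))) =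
        z * starRingEnd ℂ (f.1 (inv σ)) := fun z σ => by
      rw [inv_mk, equivariantEquiv_mk, map_mul, ← Circle.coe_inv_eq_conj, inv_inv]
    constructor
    · intro H x
      obtain ⟨z, σ, rfl⟩ := exists_mk T χ x
      rw [hstar, equivariantEquiv_mk, H]
    · intro H σ
      have := H (mk T χ 1 σ)
      rwa [hstar, equivariantEquiv_mk, Circle.coe_one, one_mul, one_mul] at this
  normI_eq f := by
    have h' : ∀ z σ, ‖(equivariantEquiv T χ f).1 (mk T χ z σ)‖ = ‖f.1 σ‖ := fun z σ => by
      rw [equivariantEquiv_mk, norm_mul, Circle.norm_coe, one_mul]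
    rw [normI, normI]
    congr 1
    · refine iSup_congr fun u => ?_
      rw [lintegral_haarInv, lintegral_haarInv]
      refine lintegral_haar_eq T χ lam (f := invCc f.1) (f' := invCc (equivariantEquiv T χ f).1)
        (fun α σ => ?_) (fun z σ => h' _ _) u
      change ‖f.1 (inv (T.act α σ))‖ = ‖f.1 (inv σ)‖
      rw [inv_act, norm_apply_act]
    · exact iSup_congr fun u => lintegral_haar_eq T χ lam (norm_apply_act T χ f) h' u
  inner_eq u f g := by
    rw [inner_toL2, inner_toL2]
    have h1 : ∀ z : Circle, starRingEnd ℂ (z : ℂ) * z = 1 := fun z => by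
      rw [← Circle.coe_inv_eq_conj, Circle.coe_inv, inv_mul_cancel₀ (Circle.coe_ne_zero _)]
    refine integral_haarInv_eq T χ lam (φ := star f.1 * g.1)
      (φ' := star (equivariantEquiv T χ f).1 * (equivariantEquiv T χ g).1) (fun α σ => ?_)
      (fun z σ => ?_) u
    · change starRingEnd ℂ (f.1 (T.act α σ)) * g.1 (T.act α σ) = starRingEnd ℂ (f.1 σ) * g.1 σ
      rw [f.2 α, g.2 α, map_mul]
      linear_combination (starRingEnd ℂ (f.1 σ) * g.1 σ) * h1 (χ α)
    · change starRingEnd ℂ ((equivariantEquiv T χ f).1 (mk T χ z σ)) *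
        (equivariantEquiv T χ g).1 (mk T χ z σ) = starRingEnd ℂ (f.1 σ) * g.1 σ
      rw [equivariantEquiv_mk, equivariantEquiv_mk, map_mul]
      linear_combination (starRingEnd ℂ (f.1 σ) * g.1 σ) * h1 z

end Push

end Twist

end GammaTwist

open GammaTwist in
theorem corollary6p4
    {Γ : Type w} [CommGroup Γ] [TopologicalSpace Γ] [IsTopologicalGroup Γ] [T2Space Γ]
    [CompactSpace Γ]
    {G : Type u} [TopologicalSpace G] [TopologicalGroupoid G] [LocallyCompactSpace G] [T2Space G]
    (lam : HaarSystem G)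
    {S : Type v} [TopologicalSpace S] [TopologicalGroupoid S] [LocallyCompactSpace S] [T2Space S]
    (T : Twist Γ G S) (χ : Γ →ₜ* Circle) :
    ∃ (S' : Type v) (_ : TopologicalSpace S') (_ : TopologicalGroupoid S')
      (_ : LocallyCompactSpace S') (_ : T2Space S') (T' : Twist Circle G S') (θ : S → S')
      (Υ : T.equivariantCc χ ≃ₗ[ℂ] T'.equivariantCc (ContinuousMonoidHom.id Circle)),
      Continuous θ ∧ IsGroupoidHom θ ∧
      (∀ u α, θ (T.ι (u, α)) = T'.ι (u, χ α)) ∧ (∀ σ, T'.π (θ σ) = T.π σ) ∧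
      (∀ f σ, (Υ f).1 (θ σ) = f.1 σ) ∧
      (∀ f g, ∃ h, (∀ σ, h.1 σ = T.conv lam f.1 g.1 σ) ∧
        ∀ σ', (Υ h).1 σ' = T'.conv lam (Υ f).1 (Υ g).1 σ') ∧
      (∀ f, ∃ h, (∀ σ, h.1 σ = starRingEnd ℂ (f.1 (TopologicalGroupoid.inv σ))) ∧
        ∀ σ', (Υ h).1 σ' = starRingEnd ℂ ((Υ f).1 (TopologicalGroupoid.inv σ'))) ∧
      (∃ Φ : T.FullCStar χ lam ≃⋆ₐ[ℂ] T'.FullCStar (ContinuousMonoidHom.id Circle) lam,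
        ∀ f, ∃ x, T.IsFullImage χ lam f x.val ∧ T'.IsFullImage _ lam (Υ f) (Φ x).val) ∧
      (∃ Φ : T.ReducedCStar χ lam ≃⋆ₐ[ℂ] T'.ReducedCStar (ContinuousMonoidHom.id Circle) lam,
        ∀ f, ∃ x, T.IsReducedImage χ lam f x.val ∧ T'.IsReducedImage _ lam (Υ f) (Φ x).val) := by
  have he := Twist.Push.isCompatible_equivariantEquiv T χ lam
  refine ⟨T.Push χ, inferInstance, inferInstance, inferInstance, inferInstance,
    Twist.Push.twist T χ, Twist.Push.toPush T χ, Twist.Push.equivariantEquiv T χ,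
    Twist.Push.continuous_toPush T χ, Twist.Push.hom_toPush T χ, Twist.Push.toPush_ι T χ,
    fun _ => rfl, fun f σ => ?_, fun f g => ?_, fun f => ?_, he.exists_fullCStar_equiv,
    he.exists_reducedCStar_equiv⟩
  · rw [Twist.Push.toPush, Twist.Push.equivariantEquiv_mk, Circle.coe_one, one_mul]
  · exact ⟨T.convE χ lam f g, fun _ => rfl,
      (he.conv_iff f g (T.convE χ lam f g)).1 fun _ => rfl⟩
  · exact ⟨T.involution χ f, fun _ => rfl, (he.star_iff f (T.involution χ f)).1 fun _ => rfl⟩
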